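/- Conventions. Let $\Sigma$ be a finite set of primes. An integer $m$ is a $\Sigma$-unit if all its prime divisors lie in $\Sigma$, and is $\Sigma$-square-free if it is a product of a $\Sigma$-unit and a square-free integer; it is composite if $|m|>1$ and $|m|$ is not prime. For $k\ge 1$ and $a_1,\dots,a_k,b_1,\dots,b_k\in\mathbb Z$ put $L_i(n)=a_in+b_i$, and for real $x,z\ge 2$ let $P_\Sigma(z)=\prod_{p<z,\ p\notin\Sigma}p$ ($p$ prime), $$\Omega(x,z)=\{n\in\mathbb Z:1\le n\le x,\ \gcd(L_1(n)\cdots L_k(n),P_\Sigma(z))=1\},$$ $$\Omega_1(x,z)=\{n\in\Omega(x,z): L_1(n),\dots,L_k(n)\text{ are }\Sigma\text{-square-free composite numbers}\}.$$ Say that $(\Sigma,a,b)$ satisfies (H) if $a_i\ne0$ and $\gcd(a_i,b_i)=1$ for all $i$, $a_ib_j-a_jb_i\ne0$ for all $i<j$, and $\Sigma$ contains all primes $p\le 2k$, all prime divisors of every $a_i$ and all prime divisors of every $a_ib_j-a_jb_i$ with $i\ne j$. For integers $k\ge1$, $s\ge0$, call $(\eta,c_1)$, with $\eta,c_1\in(0,1/2]$,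 sieving constants for $(k,s)$ if for all $a_1,\dots,a_k,b_1,\dots,b_k\in\mathbb Z$ there is $z_1\ge2$ such that, for every $\Sigma$ with $\#\Sigma=s$ for which (H) holds, $$\#\Omega_1(x,z)\ \ge\ c_1\frac{x}{(\log z)^k}\qquad\text{whenever } x\ge 2,\ x^\eta\ge z\ge z_1 .$$ The relative upper density of a set $\mathcal P$ of primes is $\bar\delta(\mathcal P)=\limsup_{x\to+\infty}\#(\mathcal P\cap[1,x])/\pi(x)$. **Theorem.** Let $k\ge1$ and $s\ge0$ be integers. Sieving constants for $(k,s)$ exist. Moreover, let $(\eta,c_1)$ be any sieving constants for $(k,s)$. Then there is $\varepsilon\in(0,1/2]$, depending only on $k$, $s$ and these constants, with the following property. Let $\Sigma$ be a set of $s$ primes and $a_1,\dots,a_k,b_1,\dots,b_k$ integers such that (H) holds and every $a_i$ is divisible by every prime in $\Sigma$. Then for every set $\mathcal P$ of primes with $\bar\delta(\mathcal P)\le\varepsilon$ there is $x_0\ge2$ (depending on $a_1,\dots,a_k,b_1,\dots,b_k$ and $\mathcal P$) such that for every real $x\ge x_0$ at least half of the elements $n$ of $\Omega_1(x,x^\eta)$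 satisfy $p\nmid L_1(n)\cdots L_k(n)$ for all $p\in\mathcal P$. -/

import Mathlib

/-- `m` is a `S`-unit: all its prime divisors belong to `S`. -/
def IsSigmaUnit (S : Finset ℕ) (m : ℤ) : Prop :=
  ∀ p : ℕ, p.Prime → (p : ℤ) ∣ m → p ∈ S

/-- `m` is `S`-square-free: a product of a `S`-unit and a square-free integer. -/
def IsSigmaSquarefree (S : Finset ℕ) (m : ℤ) : Prop :=
  ∃ u v : ℤ, IsSigmaUnit S u ∧ Squarefree v ∧ m = u * v

/-- An integer is composite when its absolute value exceeds `1` and is not a prime. -/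
def IsCompositeInt (m : ℤ) : Prop :=
  1 < m.natAbs ∧ ¬ m.natAbs.Prime

/-- The product of all primes `p < z` that are not in `S`
(`p < ⌈z⌉₊` is the same as `p < z`). -/
noncomputable def sievePrimorial (S : Finset ℕ) (z : ℝ) : ℕ :=
  ∏ p ∈ (Finset.range ⌈z⌉₊).filter (fun p => p.Prime ∧ p ∉ S), p

/-- The linear form `L i (n) = a i * n + b i`. -/
def linForm {k : ℕ} (a b : Fin k → ℤ) (i : Fin k) (n : ℕ) : ℤ :=
  a i * (n : ℤ) + b i

open Classical in
/-- `Ω(x, z)`: the integers `1 ≤ n ≤ x` such that `L 1 (n) ⋯ L k (n)` is coprime to all primes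
`p < z` outside `S`. -/
noncomputable def sieveOmega {k : ℕ} (S : Finset ℕ) (a b : Fin k → ℤ) (x z : ℝ) : Finset ℕ :=
  (Finset.Icc 1 ⌊x⌋₊).filter
    (fun n => Int.gcd (∏ i, linForm a b i n) (sievePrimorial S z : ℤ) = 1)

open Classical in
/-- `Ω₁(x, z)`: the elements `n` of `Ω(x, z)` such that `L 1 (n), …, L k (n)` are `S`-square-free
composite numbers. -/
noncomputable def sieveOmegaOne {k : ℕ} (S : Finset ℕ) (a b : Fin k → ℤ) (x z : ℝ) : Finset ℕ :=
  (sieveOmega S a b x z).filter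
    (fun n => ∀ i, IsSigmaSquarefree S (linForm a b i n) ∧ IsCompositeInt (linForm a b i n))

/-- The conditions on the finite set of primes `S` and on the coefficients of the linear forms. -/
structure SieveHypotheses {k : ℕ} (S : Finset ℕ) (a b : Fin k → ℤ) : Prop where
  prime_of_mem : ∀ p ∈ S, p.Prime
  coeff_ne_zero : ∀ i, a i ≠ 0
  gcd_eq_one : ∀ i, Int.gcd (a i) (b i) = 1
  det_ne_zero : ∀ i j, i < j → a i * b j - a j * b i ≠ 0
  small_primes : ∀ p : ℕ, p.Prime → p ≤ 2 * k → p ∈ S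
  coeff_unit : ∀ i, IsSigmaUnit S (a i)
  det_unit : ∀ i j, i ≠ j → IsSigmaUnit S (a i * b j - a j * b i)

/-- `η` and `c₁` are constants for the sieving lower bound, valid for all systems of `k` linear
forms and all sets `S` of `s` primes that satisfy the hypotheses: whenever `z₁ ≤ z ≤ x ^ η`, with
`z₁` depending only on the linear forms (and on `k`, `s`), the set `Ω₁(x, z)` has at least
`c₁ x / (log z) ^ k` elements. -/
def AreSievingConstants (k s : ℕ) (η c₁ : ℝ) : Prop :=
  η ∈ Set.Ioc (0 : ℝ) (1 / 2) ∧ c₁ ∈ Set.Ioc (0 : ℝ) (1 / 2) ∧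
    ∀ a b : Fin k → ℤ, ∃ z₁ : ℝ, 2 ≤ z₁ ∧
      ∀ S : Finset ℕ, S.card = s → SieveHypotheses S a b →
        ∀ x z : ℝ, 2 ≤ x → z₁ ≤ z → z ≤ x ^ η →
          c₁ * (x / Real.log z ^ k) ≤ ((sieveOmegaOne S a b x z).card : ℝ)

/-- The relative upper density of a set `P` of primes:
the upper limit of `#(P ∩ [1, x]) / π(x)` as the real number `x` tends to infinity. -/
noncomputable def relUpperDensity (P : Set ℕ) : ℝ :=
  Filter.limsup
    (fun x : ℝ => ((P ∩ Set.Icc 1 ⌊x⌋₊).ncard : ℝ) / (Nat.primeCounting ⌊x⌋₊ : ℝ))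
    Filter.atTop

/-! Everything rests on one sieve with a crude but uniform error. For `k` linear forms and any set
of primes outside `S` below a level `y`, the sifted count lies between half and twice `N * ∏ (1 - ρ
p / p)`, up to an error `y ^ E` with `E` depending only on `k` (`sieve_bounds`, `linForm_sieve`).
This is the Brun-Hooley sieve: the primes are cut into blocks from `2 ^ 2 ^ j` to its square,
Bonferroni's inequalities are truncated in each block separately, later for smaller blocks, and
Hooley's inequality recovers a lower bound from a product of upper bounds (`brun_hooley`).
Mertens-type estimates turn the products into powers of logarithms.

Existence of sieving constants: the lower sieve gives `Ω(x, z)` at least `c x / (log z) ^ k`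
elements, up to a power of `z`. An element is lost only if some form takes a small value, a value
divisible by the square of a prime `p ≥ z` outside `S`, or a prime value at least `y = x ^ η₀`. The
first two losses are of order `√x` and `x / z + √x`. For the third, all forms are sieved up to `z`
and one form up to `y`; this saves a factor `log z / log y ≤ η / η₀` over the main term, so a small
`η` makes it harmless (`card_le_of_sifted`).

Sparse sets of primes: let `z = x ^ η`, and let `p ∈ P` divide `L i (n)` with `n` in `Ω₁(x, z)`. The
primes of `S` divide `a i` but not `b i`, so `p` is outside `S` and `p ≥ z`. As `L i (n)` is
composite, its cofactor also has a prime factor at least `z`, whence `p * z ≪ x`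
(`le_of_dvd_of_mem_sieveOmegaOne`). The progression of such `n` modulo `p` therefore has length at
least a constant times a power of `x`, long enough to be sieved to a small power of `x`, and
contains `≪ x / (p (log x) ^ k)` admissible `n`. Small density and Chebyshev's bound give `∑ 1 / p ≪
ε / η` over the relevant `p ∈ P` (`sum_inv_le_of_ncard_le`), so for small `ε` the bad `n` are fewer
than half of the guaranteed number. -/

open Finset

/-! ### Truncated inclusion-exclusion -/

/-- The sum over all subsets `D` of `Q` of `s #D * ∏ p ∈ D, f p`. -/
noncomputable def cardSum {ι : Type*} (s : ℕ → ℝ) (Q : Finset ι) (f : ι → ℝ) : ℝ :=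
  ∑ D ∈ Q.powerset, s D.card * ∏ p ∈ D, f p

/-- The signs of inclusion-exclusion, truncated after sets of size `b`. -/
noncomputable def truncSign (b i : ℕ) : ℝ := if i ≤ b then (-1) ^ i else 0

/-- The indicator of sets of size `m`. -/
noncomputable def sizeInd (m i : ℕ) : ℝ := if i = m then 1 else 0

section CardSum

variable {ι : Type*}

lemma cardSum_empty (s : ℕ → ℝ) (f : ι → ℝ) : cardSum s ∅ f = s 0 := by
  simp [cardSum]

/-- Subsets containing `a` have one more element than their trace on `Q`, hence the shifted weight.
This recursion drives the inductions on `Q` below. -/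
lemma cardSum_insert [DecidableEq ι] (s : ℕ → ℝ) {Q : Finset ι} (f : ι → ℝ) {a : ι}
    (ha : a ∉ Q) :
    cardSum s (insert a Q) f = cardSum s Q f + f a * cardSum (fun i => s (i + 1)) Q f := by
  unfold cardSum
  rw [sum_powerset_insert ha, mul_sum]
  congr 1
  refine sum_congr rfl fun D hD => ?_
  have haD : a ∉ D := fun h => ha (mem_powerset.1 hD h)
  rw [card_insert_of_notMem haD, prod_insert haD]
  ring

lemma cardSum_neg (s : ℕ → ℝ) (Q : Finset ι) (f : ι → ℝ) :
    cardSum (fun i => -s i) Q f = -cardSum s Q f := by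
  simp [cardSum]

lemma cardSum_nonneg {s : ℕ → ℝ} (hs : ∀ i, 0 ≤ s i) {Q : Finset ι} {f : ι → ℝ}
    (hf : ∀ p ∈ Q, 0 ≤ f p) : 0 ≤ cardSum s Q f :=
  sum_nonneg fun _ hD => mul_nonneg (hs _) (prod_nonneg fun p hp => hf p (mem_powerset.1 hD hp))

lemma truncSign_succ_succ (b : ℕ) :
    (fun i => truncSign (b + 1) (i + 1)) = fun i => -truncSign b i := by
  ext i
  simp only [truncSign, add_le_add_iff_right]
  split_ifs <;> simp [pow_succ]

lemma truncSign_zero_succ : (fun i => truncSign 0 (i + 1)) = fun _ => 0 := by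
  ext i
  simp [truncSign]

lemma sizeInd_succ_succ (m : ℕ) : (fun i => sizeInd (m + 1) (i + 1)) = sizeInd m := by
  ext i
  simp [sizeInd]

lemma cardSum_zero_fun (Q : Finset ι) (f : ι → ℝ) : cardSum (fun _ => 0) Q f = 0 := by
  simp [cardSum]

lemma cardSum_sizeInd_zero (Q : Finset ι) (f : ι → ℝ) : cardSum (sizeInd 0) Q f = 1 := by
  classical
  induction Q using Finset.induction_on with
  | empty => simp [cardSum_empty, sizeInd]
  | insert a Q ha ih =>
    rw [cardSum_insert _ _ ha, ih]
    have : (fun i => sizeInd 0 (i + 1)) = fun _ => 0 := by ext i; simp [sizeInd]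
    rw [this, cardSum_zero_fun]; simp

/-- Bonferroni's inequalities for a product `∏ (1 - f p)` with `0 ≤ f p ≤ 1`. -/
lemma bonferroni {Q : Finset ι} {f : ι → ℝ} (h0 : ∀ p ∈ Q, 0 ≤ f p) (h1 : ∀ p ∈ Q, f p ≤ 1) :
    ∀ b : ℕ, 0 ≤ (-1) ^ b * (cardSum (truncSign b) Q f - ∏ p ∈ Q, (1 - f p)) ∧
      (-1) ^ b * (cardSum (truncSign b) Q f - ∏ p ∈ Q, (1 - f p)) ≤
        cardSum (sizeInd (b + 1)) Q f := by
  classical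
  induction Q using Finset.induction_on with
  | empty => intro b; simp [cardSum_empty, truncSign, sizeInd]
  | insert a Q ha ih =>
    have ih := ih (fun p hp => h0 p (mem_insert_of_mem hp)) (fun p hp => h1 p (mem_insert_of_mem hp))
    have ha0 := h0 a (mem_insert_self a Q)
    have ha1 := h1 a (mem_insert_self a Q)
    have hV0 : 0 ≤ ∏ p ∈ Q, (1 - f p) :=
      prod_nonneg fun p hp => sub_nonneg.2 (h1 p (mem_insert_of_mem hp))
    have hV1 : ∏ p ∈ Q, (1 - f p) ≤ 1 :=
      prod_le_one (fun p hp => sub_nonneg.2 (h1 p (mem_insert_of_mem hp)))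
        fun p hp => by linarith [h0 p (mem_insert_of_mem hp)]
    intro b
    rw [cardSum_insert _ _ ha, cardSum_insert _ _ ha, prod_insert ha, sizeInd_succ_succ]
    cases b with
    | zero =>
      rw [truncSign_zero_succ, cardSum_zero_fun, cardSum_sizeInd_zero]
      obtain ⟨l, r⟩ := ih 0
      simp only [pow_zero, one_mul] at l r ⊢
      constructor
      · nlinarith
      · nlinarith
    | succ b =>
      rw [truncSign_succ_succ, cardSum_neg]
      obtain ⟨l, r⟩ := ih (b + 1)
      obtain ⟨l', r'⟩ := ih b
      -- The shifted signs are truncated one level lower and reversed, so the signed error at level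
      -- `b + 1` is a nonnegative combination of the errors for `Q` at levels `b + 1` and `b`. This
      -- is why the induction carries all levels at once.
      have e : (-1 : ℝ) ^ (b + 1) * (cardSum (truncSign (b + 1)) Q f +
          f a * -cardSum (truncSign b) Q f - (1 - f a) * ∏ p ∈ Q, (1 - f p)) =
          (-1) ^ (b + 1) * (cardSum (truncSign (b + 1)) Q f - ∏ p ∈ Q, (1 - f p)) +
          f a * ((-1) ^ b * (cardSum (truncSign b) Q f - ∏ p ∈ Q, (1 - f p))) := by
        rw [pow_succ]; ring
      rw [e]
      exact ⟨add_nonneg l (mul_nonneg ha0 l'), add_le_add r (mul_le_mul_of_nonneg_left r' ha0)⟩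

/-- In the expansion of the `m`-th power of the sum, each product over a set of size `m` occurs `m!`
times. The induction needs only the first two terms of the binomial expansion of `(f a + S) ^ (m +
1)`. -/
lemma cardSum_sizeInd_le {Q : Finset ι} {f : ι → ℝ} (h0 : ∀ p ∈ Q, 0 ≤ f p) :
    ∀ m : ℕ, cardSum (sizeInd m) Q f ≤ (∑ p ∈ Q, f p) ^ m / m.factorial := by
  classical
  induction Q using Finset.induction_on with
  | empty =>
    intro m
    cases m <;> simp [cardSum_empty, sizeInd]
  | insert a Q ha ih =>
    have h0' := fun p hp => h0 p (mem_insert_of_mem hp)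
    have ih := ih h0'
    have ha0 := h0 a (mem_insert_self a Q)
    have hS : 0 ≤ ∑ p ∈ Q, f p := sum_nonneg h0'
    intro m
    cases m with
    | zero => simp [cardSum_sizeInd_zero]
    | succ m =>
      rw [cardSum_insert _ _ ha, sizeInd_succ_succ, sum_insert ha]
      set S := ∑ p ∈ Q, f p
      have key : S ^ (m + 1) + (m + 1) * f a * S ^ m ≤ (f a + S) ^ (m + 1) := by
        clear ih
        induction m with
        | zero => simp; linarith
        | succ m ihm =>
          have := mul_le_mul_of_nonneg_right ihm (add_nonneg ha0 hS)
          rw [pow_succ (f a + S)]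
          refine le_trans ?_ this
          have : 0 ≤ (m + 1) * f a * f a * S ^ m := by positivity
          push_cast
          rw [pow_succ S (m + 1), pow_succ S m]
          nlinarith
      calc _ ≤ S ^ (m + 1) / (m + 1).factorial + f a * (S ^ m / m.factorial) :=
            add_le_add (ih _) (mul_le_mul_of_nonneg_left (ih _) ha0)
        _ = (S ^ (m + 1) + (m + 1) * f a * S ^ m) / (m + 1).factorial := by
            rw [Nat.factorial_succ]; push_cast
            have : (m.factorial : ℝ) ≠ 0 := by positivity
            field_simp
        _ ≤ _ := by gcongr

/-- Each product over at most `m` elements occurs in the expansion of `(1 + ∑ f) ^ m`. This bounds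
the accumulated remainder of a truncated block. -/
lemma cardSum_le_pow {Q : Finset ι} {f : ι → ℝ} (h0 : ∀ p ∈ Q, 0 ≤ f p) :
    ∀ (m : ℕ) (s : ℕ → ℝ), (∀ i, 0 ≤ s i) → (∀ i, s i ≤ 1) → (∀ i, m < i → s i = 0) →
      cardSum s Q f ≤ (1 + ∑ p ∈ Q, f p) ^ m := by
  classical
  induction Q using Finset.induction_on with
  | empty => intro m s _ hs1 _; simpa [cardSum_empty] using hs1 0
  | insert a Q ha ih =>
    have h0' := fun p hp => h0 p (mem_insert_of_mem hp)
    have ih := ih h0'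
    have ha0 := h0 a (mem_insert_self a Q)
    have hS : 0 ≤ ∑ p ∈ Q, f p := sum_nonneg h0'
    intro m s hs0 hs1 hsm
    rw [cardSum_insert _ _ ha, sum_insert ha]
    set S := ∑ p ∈ Q, f p
    cases m with
    | zero =>
      have : (fun i => s (i + 1)) = fun _ => 0 := by ext i; exact hsm _ (by omega)
      rw [this, cardSum_zero_fun]
      simpa using ih 0 s hs0 hs1 hsm
    | succ m =>
      have h1 := ih (m + 1) s hs0 hs1 hsm
      have h2 := ih m (fun i => s (i + 1)) (fun i => hs0 _) (fun i => hs1 _)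
        (fun i hi => hsm _ (by omega))
      calc _ ≤ (1 + S) ^ (m + 1) + f a * (1 + S) ^ m :=
            add_le_add h1 (mul_le_mul_of_nonneg_left h2 ha0)
        _ = (1 + (f a + S)) * (1 + S) ^ m := by ring
        _ ≤ (1 + (f a + S)) * (1 + (f a + S)) ^ m := by
            gcongr
            linarith
        _ = _ := by ring

/-- Expanding a product of weights `cardSum (s j) (Q j)` over disjoint blocks of primes, the
average over `A` is the value at the densities `g`, up to the value at the remainders `h`. -/
lemma abs_sum_prod_cardSum_sub_le {α : Type*} [DecidableEq ι] (A : Finset α) (u : α → ι → ℝ)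
    (X : ℝ) (g h : ι → ℝ) (U : Finset ι)
    (H : ∀ D ⊆ U, |∑ n ∈ A, ∏ p ∈ D, u n p - X * ∏ p ∈ D, g p| ≤ ∏ p ∈ D, h p)
    (s : ℕ → ℕ → ℝ) (Q : ℕ → Finset ι) (J : Finset ℕ) (hQ : ∀ j ∈ J, Q j ⊆ U)
    (hd : ∀ i ∈ J, ∀ j ∈ J, i ≠ j → Disjoint (Q i) (Q j)) :
    ∀ D ⊆ U, (∀ j ∈ J, Disjoint (Q j) D) →
      |∑ n ∈ A, (∏ j ∈ J, cardSum (s j) (Q j) (u n)) * ∏ p ∈ D, u n p -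
        X * ((∏ j ∈ J, cardSum (s j) (Q j) g) * ∏ p ∈ D, g p)| ≤
      (∏ j ∈ J, cardSum (fun i => |s j i|) (Q j) h) * ∏ p ∈ D, h p := by
  induction J using Finset.induction_on with
  | empty => intro D hD _; simpa using H D hD
  | insert a J ha ih =>
    intro D hD hDJ
    have ih := ih (fun j hj => hQ j (mem_insert_of_mem hj))
      (fun i hi j hj => hd i (mem_insert_of_mem hi) j (mem_insert_of_mem hj))
    have hdis : ∀ E ∈ (Q a).powerset, Disjoint E D := fun E hE =>
      disjoint_of_subset_left (mem_powerset.1 hE) (hDJ a (mem_insert_self a J))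
    -- The auxiliary set `D` records the elements already selected from treated blocks; selecting
    -- `E` in the block `Q a` enlarges it to `E ∪ D`.
    have key : ∀ E ∈ (Q a).powerset,
        |∑ n ∈ A, (∏ j ∈ J, cardSum (s j) (Q j) (u n)) * ∏ p ∈ E ∪ D, u n p -
        X * ((∏ j ∈ J, cardSum (s j) (Q j) g) * ∏ p ∈ E ∪ D, g p)| ≤
      (∏ j ∈ J, cardSum (fun i => |s j i|) (Q j) h) * ∏ p ∈ E ∪ D, h p := fun E hE => by
      refine ih (E ∪ D) (union_subset ((mem_powerset.1 hE).trans (hQ a (mem_insert_self a J))) hD)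
        fun j hj => ?_
      rw [disjoint_union_right]
      refine ⟨disjoint_of_subset_right (mem_powerset.1 hE) (hd j (mem_insert_of_mem hj) a
        (mem_insert_self a J) fun h => ha (h ▸ hj)), hDJ j (mem_insert_of_mem hj)⟩
    have e1 : ∀ f : ι → ℝ, ∀ s' : ℕ → ℕ → ℝ,
        (∏ j ∈ insert a J, cardSum (s' j) (Q j) f) * ∏ p ∈ D, f p =
        ∑ E ∈ (Q a).powerset, s' a E.card *
          ((∏ j ∈ J, cardSum (s' j) (Q j) f) * ∏ p ∈ E ∪ D, f p) := fun f s' => by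
      rw [prod_insert ha, cardSum, sum_mul, sum_mul]
      refine sum_congr rfl fun E hE => ?_
      rw [prod_union (hdis E hE)]; ring
    simp_rw [e1 _ s, e1 _ (fun j i => |s j i|)]
    rw [sum_comm, mul_sum, ← sum_sub_distrib]
    refine (abs_sum_le_sum_abs _ _).trans (sum_le_sum fun E hE => ?_)
    rw [← mul_sum, mul_left_comm, ← mul_sub, abs_mul]
    exact mul_le_mul_of_nonneg_left (key E hE) (abs_nonneg _)

end CardSum

/-! ### The Brun-Hooley sieve -/

/-- Hooley's inequality for products of upper bounds. -/
lemma prod_sub_sum_le_prod {x y d : ℕ → ℝ} (J : Finset ℕ) (hx : ∀ j ∈ J, 0 ≤ x j)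
    (hxy : ∀ j ∈ J, x j ≤ y j) (hd : ∀ j ∈ J, y j - x j ≤ d j) :
    ∏ j ∈ J, y j - ∑ l ∈ J, d l * ∏ j ∈ J.erase l, y j ≤ ∏ j ∈ J, x j := by
  induction J using Finset.induction_on with
  | empty => simp
  | insert a J ha ih =>
    have ih := ih (fun j hj => hx j (mem_insert_of_mem hj))
      (fun j hj => hxy j (mem_insert_of_mem hj)) (fun j hj => hd j (mem_insert_of_mem hj))
    have hxa := hx a (mem_insert_self a J)
    have hxya := hxy a (mem_insert_self a J)
    have hda := hd a (mem_insert_self a J)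
    have hy : ∀ j ∈ J, 0 ≤ y j := fun j hj =>
      (hx j (mem_insert_of_mem hj)).trans (hxy j (mem_insert_of_mem hj))
    have hP : 0 ≤ ∏ j ∈ J, y j := prod_nonneg hy
    have hS : 0 ≤ ∑ l ∈ J, d l * ∏ j ∈ J.erase l, y j := by
      refine sum_nonneg fun l hl => mul_nonneg ?_ (prod_nonneg fun j hj => hy j (mem_of_mem_erase hj))
      linarith [hd l (mem_insert_of_mem hl), hxy l (mem_insert_of_mem hl)]
    rw [prod_insert ha, prod_insert ha, sum_insert ha, erase_insert ha]
    have e : ∑ l ∈ J, d l * ∏ j ∈ (insert a J).erase l, y j =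
        y a * ∑ l ∈ J, d l * ∏ j ∈ J.erase l, y j := by
      rw [mul_sum]
      refine sum_congr rfl fun l hl => ?_
      have hla : a ≠ l := fun h => ha (h ▸ hl)
      rw [erase_insert_of_ne hla, prod_insert (fun h => ha (mem_of_mem_erase h))]
      ring
    rw [e]
    have h1 := mul_le_mul_of_nonneg_left ih hxa
    nlinarith [mul_le_mul_of_nonneg_right hda hP, mul_le_mul_of_nonneg_right hxya hS]

/-- The Brun-Hooley sieve: inclusion-exclusion is truncated separately in each block of primes. -/
theorem brun_hooley {α ι : Type*} [DecidableEq ι] (A : Finset α) (u : α → ι → ℝ) {X : ℝ}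
    (hX : 0 ≤ X) (g h : ι → ℝ) (Q : ℕ → Finset ι) (J : Finset ℕ) (b : ℕ → ℕ) (δ : ℕ → ℝ)
    (hu0 : ∀ n p, 0 ≤ u n p) (hu1 : ∀ n p, u n p ≤ 1) (hg0 : ∀ p, 0 ≤ g p) (hg1 : ∀ p, g p ≤ 1)
    (hh : ∀ p, 0 ≤ h p)
    (H : ∀ D ⊆ J.biUnion Q, |∑ n ∈ A, ∏ p ∈ D, u n p - X * ∏ p ∈ D, g p| ≤ ∏ p ∈ D, h p)
    (hd : ∀ i ∈ J, ∀ j ∈ J, i ≠ j → Disjoint (Q i) (Q j)) (hb : ∀ j, Even (b j))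
    (hδ0 : ∀ j ∈ J, 0 ≤ δ j)
    (hδ : ∀ j ∈ J, cardSum (sizeInd (b j + 1)) (Q j) g ≤ δ j * ∏ p ∈ Q j, (1 - g p))
    (hδs : ∑ j ∈ J, δ j ≤ 1 / 2) :
    X * (∏ p ∈ J.biUnion Q, (1 - g p)) / 2 -
        (J.card + 1) * ∏ j ∈ J, (1 + ∑ p ∈ Q j, h p) ^ (b j + 1) ≤
      ∑ n ∈ A, ∏ p ∈ J.biUnion Q, (1 - u n p) ∧
    ∑ n ∈ A, ∏ p ∈ J.biUnion Q, (1 - u n p) ≤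
      2 * X * (∏ p ∈ J.biUnion Q, (1 - g p)) +
        (J.card + 1) * ∏ j ∈ J, (1 + ∑ p ∈ Q j, h p) ^ (b j + 1) := by
  set Err := ∏ j ∈ J, (1 + ∑ p ∈ Q j, h p) ^ (b j + 1) with hErr
  have hErr0 : 0 ≤ Err := prod_nonneg fun j _ =>
    pow_nonneg (add_nonneg zero_le_one (sum_nonneg fun p _ => hh p)) _
  have hU : ∀ f : ι → ℝ, ∏ p ∈ J.biUnion Q, (1 - f p) = ∏ j ∈ J, ∏ p ∈ Q j, (1 - f p) :=
    fun f => prod_biUnion fun i hi j hj hij => hd i hi j hj hij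
  simp_rw [hU]
  have bon : ∀ f : ι → ℝ, (∀ p, 0 ≤ f p) → (∀ p, f p ≤ 1) → ∀ j,
      ∏ p ∈ Q j, (1 - f p) ≤ cardSum (truncSign (b j)) (Q j) f ∧
      cardSum (truncSign (b j)) (Q j) f - ∏ p ∈ Q j, (1 - f p) ≤
        cardSum (sizeInd (b j + 1)) (Q j) f := fun f h0 h1 j => by
    have := bonferroni (Q := Q j) (f := f) (fun p _ => h0 p) (fun p _ => h1 p) (b j)
    rw [(hb j).neg_one_pow, one_mul] at this
    exact ⟨by linarith [this.1], this.2⟩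
  -- The error estimate for any choice of weights
  have err : ∀ s : ℕ → ℕ → ℝ, (∀ j i, |s j i| ≤ 1) → (∀ j i, b j + 1 < i → s j i = 0) →
      |∑ n ∈ A, (∏ j ∈ J, cardSum (s j) (Q j) (u n)) - X * ∏ j ∈ J, cardSum (s j) (Q j) g| ≤
        Err := fun s hs1 hs0 => by
    have := abs_sum_prod_cardSum_sub_le A u X g h _ H s Q J
      (fun j hj => subset_biUnion_of_mem Q hj) hd ∅ (empty_subset _) (fun j _ => disjoint_empty_right _)
    simp only [prod_empty, mul_one] at this
    refine this.trans (prod_le_prod (fun j _ => cardSum_nonneg (fun i => abs_nonneg _)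
      fun p _ => hh p) fun j _ => cardSum_le_pow (fun p _ => hh p) _ _ (fun i => abs_nonneg _)
        (fun i => hs1 j i) fun i hi => by rw [hs0 j i hi, abs_zero])
  have tr1 : ∀ j i, |truncSign (b j) i| ≤ 1 := fun j i => by
    unfold truncSign; split_ifs <;> simp
  have tr0 : ∀ j i, b j + 1 < i → truncSign (b j) i = 0 := fun j i hi => by
    unfold truncSign; rw [if_neg (by omega)]
  have errT := err (fun j => truncSign (b j)) tr1 tr0
  set Y := fun j => cardSum (truncSign (b j)) (Q j) g with hY
  set V := fun j => ∏ p ∈ Q j, (1 - g p) with hV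
  have hV0 : ∀ j, 0 ≤ V j := fun j => prod_nonneg fun p _ => sub_nonneg.2 (hg1 p)
  have hVY : ∀ j, V j ≤ Y j := fun j => (bon g hg0 hg1 j).1
  constructor
  · have errE : ∀ l ∈ J, |∑ n ∈ A, (cardSum (sizeInd (b l + 1)) (Q l) (u n) *
        ∏ j ∈ J.erase l, cardSum (truncSign (b j)) (Q j) (u n)) -
        X * (cardSum (sizeInd (b l + 1)) (Q l) g * ∏ j ∈ J.erase l, Y j)| ≤ Err := fun l hl => by
      -- In block `l` the truncated signs are replaced by the first omitted term, of size `b l + 1`;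
      -- the remainder estimate allows this size for that reason.
      have := err (Function.update (fun j => truncSign (b j)) l (sizeInd (b l + 1)))
        (fun j i => by
          by_cases hj : j = l
          · subst hj; rw [Function.update_self]; unfold sizeInd; split_ifs <;> simp
          · rw [Function.update_of_ne hj]; exact tr1 j i)
        (fun j i hi => by
          by_cases hj : j = l
          · subst hj; rw [Function.update_self]; unfold sizeInd; rw [if_neg (by omega)]
          · rw [Function.update_of_ne hj]; exact tr0 j i hi)
      have e : ∀ f : ι → ℝ, ∏ j ∈ J, cardSum (Function.update (fun j => truncSign (b j)) l
          (sizeInd (b l + 1)) j) (Q j) f = cardSum (sizeInd (b l + 1)) (Q l) f *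
          ∏ j ∈ J.erase l, cardSum (truncSign (b j)) (Q j) f := fun f => by
        rw [← mul_prod_erase J _ hl, Function.update_self]
        congr 1
        refine prod_congr rfl fun j hj => ?_
        rw [Function.update_of_ne (ne_of_mem_erase hj)]
      simp_rw [e] at this
      exact this
    -- Even truncation gives an upper bound in every block, so Hooley's inequality applies for each
    -- `n`. Its correction terms are again weighted sums covered by the remainder estimate.
    have h1 : ∑ n ∈ A, (∏ j ∈ J, cardSum (truncSign (b j)) (Q j) (u n) -
        ∑ l ∈ J, cardSum (sizeInd (b l + 1)) (Q l) (u n) *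
          ∏ j ∈ J.erase l, cardSum (truncSign (b j)) (Q j) (u n)) ≤
        ∑ n ∈ A, ∏ j ∈ J, ∏ p ∈ Q j, (1 - u n p) := sum_le_sum fun n _ =>
      prod_sub_sum_le_prod J (fun j _ => prod_nonneg fun p _ => sub_nonneg.2 (hu1 n p))
        (fun j _ => (bon (u n) (hu0 n) (hu1 n) j).1) (fun j _ => (bon (u n) (hu0 n) (hu1 n) j).2)
    rw [sum_sub_distrib, sum_comm] at h1
    have h2 : ∑ l ∈ J, ∑ n ∈ A, cardSum (sizeInd (b l + 1)) (Q l) (u n) *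
          ∏ j ∈ J.erase l, cardSum (truncSign (b j)) (Q j) (u n) ≤
        ∑ l ∈ J, (X * (δ l * ∏ j ∈ J, Y j) + Err) := sum_le_sum fun l hl => by
      have h3 := (abs_le.1 (errE l hl)).2
      have h4 : cardSum (sizeInd (b l + 1)) (Q l) g * ∏ j ∈ J.erase l, Y j ≤
          δ l * ∏ j ∈ J, Y j := by
        rw [← mul_prod_erase J Y hl, ← mul_assoc]
        refine mul_le_mul_of_nonneg_right ((hδ l hl).trans
          (mul_le_mul_of_nonneg_left (hVY l) (hδ0 l hl))) (prod_nonneg fun j _ => (hV0 j).trans (hVY j))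
      have := mul_le_mul_of_nonneg_left h4 hX
      linarith
    rw [sum_add_distrib, sum_const, nsmul_eq_mul, ← mul_sum, ← sum_mul] at h2
    have h5 := (abs_le.1 errT).1
    have hYV : ∏ j ∈ J, V j ≤ ∏ j ∈ J, Y j := prod_le_prod (fun j _ => hV0 j) fun j _ => hVY j
    have hXY : X * ∏ j ∈ J, V j ≤ X * ∏ j ∈ J, Y j := mul_le_mul_of_nonneg_left hYV hX
    have hXV0 : 0 ≤ X * ∏ j ∈ J, V j := mul_nonneg hX (prod_nonneg fun j _ => hV0 j)
    -- The corrections consume at most half of the main term.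
    have h6 : X * ((∑ l ∈ J, δ l) * ∏ j ∈ J, Y j) ≤ 1 / 2 * (X * ∏ j ∈ J, Y j) := by
      rw [mul_left_comm]
      exact mul_le_mul_of_nonneg_right hδs (hXV0.trans hXY)
    linarith
  · have h1 : ∑ n ∈ A, ∏ j ∈ J, ∏ p ∈ Q j, (1 - u n p) ≤
        ∑ n ∈ A, ∏ j ∈ J, cardSum (truncSign (b j)) (Q j) (u n) := sum_le_sum fun n _ =>
      prod_le_prod (fun j _ => prod_nonneg fun p _ => sub_nonneg.2 (hu1 n p))
        fun j _ => (bon (u n) (hu0 n) (hu1 n) j).1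
    have h2 := (abs_le.1 errT).2
    -- Blockwise `Y j ≤ (1 + δ j) * V j ≤ exp (δ j) * V j`, so the total loss is at most `exp (1 /
    -- 2) ≤ 2`.
    have h3 : ∏ j ∈ J, Y j ≤ 2 * ∏ j ∈ J, V j := by
      calc ∏ j ∈ J, Y j ≤ ∏ j ∈ J, (Real.exp (δ j) * V j) := by
            refine prod_le_prod (fun j _ => (hV0 j).trans (hVY j)) fun j hj => ?_
            have := (bon g hg0 hg1 j).2
            have h4 := hδ j hj
            have h5 := mul_le_mul_of_nonneg_right (Real.add_one_le_exp (δ j)) (hV0 j)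
            simp only [hY, hV] at *
            linarith
        _ = Real.exp (∑ j ∈ J, δ j) * ∏ j ∈ J, V j := by
            rw [prod_mul_distrib, Real.exp_sum]
        _ ≤ 2 * ∏ j ∈ J, V j := by
            refine mul_le_mul_of_nonneg_right ?_ (prod_nonneg fun j _ => hV0 j)
            refine (Real.exp_le_exp.2 hδs).trans ?_
            rw [← Real.log_le_log_iff (Real.exp_pos _) (by norm_num), Real.log_exp]
            linarith [Real.log_two_gt_d9]
    have h4 := mul_le_mul_of_nonneg_left h3 hX
    have h5 : 0 ≤ (J.card : ℝ) * Err := by positivity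
    linarith

/-! ### Chebyshev and Mertens estimates -/

/-- A weak form of Mertens' first theorem. -/
lemma sum_log_div_prime_le {n : ℕ} (hn : 0 < n) :
    ∑ p ∈ n.primesLE, Real.log p / p ≤ Real.log n + Real.log 4 := by
  -- Only the first term of Legendre's formula is kept. Logarithms are then compared using `n! ≤ n ^
  -- n`, and Chebyshev's bound for `θ` pays for rounding `n / p` down.
  have hdvd : ∏ p ∈ n.primesLE, p ^ (n / p) ∣ n.factorial := by
    refine Finset.prod_dvd_of_isRelPrime (fun p hp q hq hpq => ?_) fun p hp => ?_
    · exact Nat.coprime_iff_isRelPrime.1 (Nat.Coprime.pow _ _ ((Nat.coprime_primes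
        (Nat.prime_of_mem_primesLE hp) (Nat.prime_of_mem_primesLE hq)).2 hpq))
    · refine ((Nat.prime_of_mem_primesLE hp).pow_dvd_factorial_iff
        (b := Nat.log p n + 2) (by omega)).2 ?_
      have := single_le_sum (f := fun i => n / p ^ i) (s := Ico 1 (Nat.log p n + 2))
        (fun i _ => Nat.zero_le _) (mem_Ico.2 ⟨le_refl 1, by omega⟩)
      simpa using this
  have hle := Nat.le_of_dvd n.factorial_pos hdvd
  have hle' : ((∏ p ∈ n.primesLE, p ^ (n / p) : ℕ) : ℝ) ≤ (n : ℝ) ^ n :=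
    by exact_mod_cast hle.trans (Nat.factorial_le_pow n)
  push_cast at hle'
  have hpos : ∀ p ∈ n.primesLE, (0 : ℝ) < p := fun p hp =>
    by exact_mod_cast (Nat.prime_of_mem_primesLE hp).pos
  have hlog := Real.log_le_log (prod_pos fun p hp => pow_pos (hpos p hp) _) hle'
  rw [Real.log_prod (fun p hp => (pow_pos (hpos p hp) _).ne'), Real.log_pow] at hlog
  simp_rw [Real.log_pow] at hlog
  have hθ := Chebyshev.theta_le_log4_mul_x (x := (n : ℝ)) (Nat.cast_nonneg n)
  rw [Chebyshev.theta_eq_sum_primesLE_log] at hθ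
  have hn' : (0 : ℝ) < n := by exact_mod_cast hn
  have h1 : ∑ p ∈ n.primesLE, (n * (Real.log p / p) - Real.log p) ≤
      ∑ p ∈ n.primesLE, ((n / p : ℕ) : ℝ) * Real.log p := sum_le_sum fun p hp => by
    have h2 : (n : ℝ) / p - 1 ≤ ((n / p : ℕ) : ℝ) := by
      rw [← Nat.floor_div_eq_div (K := ℝ)]
      exact (Nat.sub_one_lt_floor _).le
    have h3 : 0 ≤ Real.log p := Real.log_natCast_nonneg p
    calc _ = ((n : ℝ) / p - 1) * Real.log p := by ring
      _ ≤ _ := mul_le_mul_of_nonneg_right h2 h3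
  rw [sum_sub_distrib, ← mul_sum] at h1
  have h4 : n * ∑ p ∈ n.primesLE, Real.log p / p ≤ n * (Real.log n + Real.log 4) := by linarith
  exact le_of_mul_le_mul_left h4 hn'

lemma log_four_eq : Real.log 4 = 2 * Real.log 2 := by
  rw [show (4 : ℝ) = 2 ^ 2 by norm_num, Real.log_pow]; norm_num

/-- The sum of the reciprocals of the primes between `2 ^ 2 ^ j` and its square is bounded. -/
lemma sum_inv_prime_block_le (j : ℕ) {Q : Finset ℕ} (hQp : ∀ p ∈ Q, p.Prime)
    (hQl : ∀ p ∈ Q, 2 ^ 2 ^ j ≤ p) (hQu : ∀ p ∈ Q, p < 2 ^ 2 ^ (j + 1)) :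
    ∑ p ∈ Q, (1 : ℝ) / p ≤ 4 := by
  have hl2 : 0 < Real.log 2 := Real.log_pos one_lt_two
  have hM := sum_log_div_prime_le (n := 2 ^ 2 ^ (j + 1)) (by positivity)
  -- On the block `log p ≥ 2 ^ j * log 2`, while the Mertens sum is at most `(2 ^ (j + 1) + 2) * log
  -- 2 ≤ 4 * 2 ^ j * log 2`.
  have h1 : ∑ p ∈ Q, (2 ^ j * Real.log 2) * ((1 : ℝ) / p) ≤
      ∑ p ∈ Nat.primesLE (2 ^ 2 ^ (j + 1)), Real.log p / p := by
    refine (sum_le_sum fun p hp => ?_).trans (sum_le_sum_of_subset_of_nonneg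
      (f := fun p : ℕ => Real.log p / p) (s := Q) ?_ fun p _ _ => ?_)
    · rw [mul_one_div]
      refine div_le_div_of_nonneg_right ?_ (Nat.cast_nonneg p)
      have : Real.log (2 ^ 2 ^ j : ℝ) ≤ Real.log p :=
        Real.log_le_log (by positivity) (by exact_mod_cast hQl p hp)
      rw [Real.log_pow] at this
      exact_mod_cast this
    · exact fun p hp => Nat.mem_primesLE.2 ⟨(hQu p hp).le, hQp p hp⟩
    · exact div_nonneg (Real.log_natCast_nonneg p) (Nat.cast_nonneg p)
  rw [← mul_sum] at h1
  push_cast at hM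
  rw [Real.log_pow, log_four_eq] at hM
  push_cast at hM
  have h2 : (1 : ℝ) ≤ 2 ^ j := one_le_pow₀ one_le_two
  have h3 : (2 ^ j * Real.log 2) * ∑ p ∈ Q, (1 : ℝ) / p ≤ (2 ^ j * Real.log 2) * 4 := by
    refine h1.trans (hM.trans ?_)
    rw [pow_succ]
    nlinarith
  exact le_of_mul_le_mul_left h3 (by positivity)

lemma prod_one_sub_inv_prime_pos (N : ℕ) : 0 < ∏ p ∈ N.primesBelow, (1 - 1 / (p : ℝ)) := by
  refine prod_pos fun p hp => ?_
  have : (1 : ℝ) < p := by exact_mod_cast Nat.one_lt_of_mem_primesBelow hp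
  rw [sub_pos, div_lt_one (by linarith)]
  exact this

/-- The upper bound in Mertens' third theorem. -/
lemma prod_one_sub_inv_prime_le {N : ℕ} (hN : 2 ≤ N) :
    ∏ p ∈ N.primesBelow, (1 - 1 / (p : ℝ)) ≤ 1 / Real.log N := by
  have hlogN : 0 < Real.log N := Real.log_pos (by exact_mod_cast hN)
  let f : ℕ →* ℝ := (invMonoidWithZeroHom.toMonoidHom).comp (Nat.castRingHom ℝ).toMonoidHom
  have hf : ∀ n, f n = (n : ℝ)⁻¹ := fun n => rfl
  have h := (EulerProduct.summable_and_hasSum_smoothNumbers_prod_primesBelow_geometric (f := f)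
    (fun {p} hp => by
      rw [hf, norm_inv, Real.norm_natCast]
      exact inv_lt_one_of_one_lt₀ (by exact_mod_cast hp.one_lt)) N).2
  simp_rw [hf] at h
  have hs : ∀ n ∈ Ico 1 N, n ∈ N.smoothNumbers := fun n hn => by
    rw [mem_Ico] at hn
    exact Nat.mem_smoothNumbers_of_lt (by omega) hn.2
  -- Every `n < N` is `N`-smooth, so the harmonic sum is part of the expanded Euler product.
  have h1 : ∑ n ∈ Ico 1 N, (n : ℝ)⁻¹ ≤ ∏ p ∈ N.primesBelow, (1 - (p : ℝ)⁻¹)⁻¹ := by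
    rw [← sum_subtype_of_mem (p := (· ∈ N.smoothNumbers)) (fun n : ℕ => (n : ℝ)⁻¹) hs]
    exact sum_le_hasSum _ (fun _ _ => inv_nonneg.2 (Nat.cast_nonneg _)) h
  have h2 : Real.log N ≤ ∑ n ∈ Ico 1 N, (n : ℝ)⁻¹ := by
    have := log_add_one_le_harmonic (N - 1)
    rw [harmonic_eq_sum_Icc] at this
    push_cast at this
    have e : ((N - 1 : ℕ) : ℝ) + 1 = N := by
      rw [← Nat.cast_succ]; congr 1; omega
    have e' : Icc 1 (N - 1) = Ico 1 N := by ext; simp; omega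
    rwa [e, e'] at this
  have h3 := h2.trans h1
  rw [prod_inv_distrib] at h3
  simp_rw [one_div]
  exact (le_inv_comm₀ hlogN (by simpa [one_div] using prod_one_sub_inv_prime_pos N)).1 h3

lemma one_le_two_mul_log {N : ℕ} (hN : 2 ≤ N) : 1 ≤ 2 * Real.log N := by
  have : Real.log 2 ≤ Real.log N := Real.log_le_log two_pos (by exact_mod_cast hN)
  linarith [Real.log_two_gt_d9]

/-- The lower bound in Mertens' third theorem. -/
lemma le_prod_one_sub_inv_prime {N : ℕ} (hN : 2 ≤ N) :
    Real.exp (-6) / 3 / Real.log N ≤ ∏ p ∈ N.primesBelow, (1 - 1 / (p : ℝ)) := by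
  have hlogN : 0 < Real.log N := Real.log_pos (by exact_mod_cast hN)
  have hlog1 := one_le_two_mul_log hN
  -- With this exponent the Euler product is at most `ζ(σ) ≤ log N + 1`, and moving from `σ` back to
  -- `1` costs only a bounded factor on primes below `N`.
  set σ : ℝ := 1 + 1 / Real.log N with hσ
  have hσ1 : 1 < σ := by rw [hσ]; linarith [one_div_pos.2 hlogN]
  let f : ℕ →* ℝ :=
    { toFun := fun n => (n : ℝ) ^ (-σ)
      map_one' := by simp
      map_mul' := fun m n => by
        push_cast
        exact Real.mul_rpow (Nat.cast_nonneg m) (Nat.cast_nonneg n) }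
  have hf : ∀ n, f n = (n : ℝ) ^ (-σ) := fun n => rfl
  have hflt : ∀ {p : ℕ}, p.Prime → (p : ℝ) ^ (-σ) < 1 := fun {p} hp =>
    Real.rpow_lt_one_of_one_lt_of_neg (by exact_mod_cast hp.one_lt) (by linarith)
  have hE := (EulerProduct.summable_and_hasSum_smoothNumbers_prod_primesBelow_geometric (f := f)
    (fun {p} hp => by
      rw [hf, Real.norm_of_nonneg (Real.rpow_nonneg (Nat.cast_nonneg p) _)]
      exact hflt hp) N).2
  simp_rw [hf] at hE
  have hsum : Summable fun n : ℕ => (n : ℝ) ^ (-σ) := Real.summable_nat_rpow.2 (by linarith)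
  have hz : ∏ p ∈ N.primesBelow, (1 - (p : ℝ) ^ (-σ))⁻¹ ≤ 3 * Real.log N := by
    have h1 : ∏ p ∈ N.primesBelow, (1 - (p : ℝ) ^ (-σ))⁻¹ ≤ ∑' n : ℕ, (n : ℝ) ^ (-σ) := by
      rw [← hE.tsum_eq]
      exact hsum.tsum_subtype_le (fun n : ℕ => (n : ℝ) ^ (-σ)) _
        fun n => Real.rpow_nonneg (Nat.cast_nonneg n) _
    have h2 : ∑' n : ℕ, (n : ℝ) ^ (-σ) = ∑' n : ℕ, 1 / (n + 1 : ℝ) ^ σ := by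
      rw [hsum.tsum_eq_zero_add]
      rw [Nat.cast_zero, Real.zero_rpow (by linarith), zero_add]
      refine tsum_congr fun n => ?_
      rw [Real.rpow_neg (Nat.cast_nonneg _), one_div]
      push_cast; rfl
    have h3 := ZetaAsymptotics.zeta_limit_aux1 hσ1
    have h4 : 0 ≤ ZetaAsymptotics.termTSum σ :=
      tsum_nonneg fun n => ZetaAsymptotics.term_nonneg _ _
    have h5 : 1 / (σ - 1) = Real.log N := by rw [hσ]; simp
    rw [h5] at h3
    have h6 : 0 ≤ σ * ZetaAsymptotics.termTSum σ := mul_nonneg (by linarith) h4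
    linarith
  -- Uses `p ^ (-σ) ≥ (1 / p) * (1 - log p / log N)` and `1 / p ≤ 1 / 2`. By Mertens' first theorem
  -- the exponents add up to at most `6`.
  have hpd : ∀ p ∈ N.primesBelow, 1 - (p : ℝ) ^ (-σ) ≤
      (1 - 1 / (p : ℝ)) * Real.exp (2 / Real.log N * (Real.log p / p)) := fun p hp => by
    have hp2 : (2 : ℝ) ≤ p := by exact_mod_cast (Nat.prime_of_mem_primesBelow hp).two_le
    have hp0 : (0 : ℝ) < p := by linarith
    have e1 : (p : ℝ) ^ (-σ) = 1 / p * Real.exp (-(Real.log p / Real.log N)) := by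
      rw [Real.rpow_def_of_pos hp0, show Real.log p * -σ = -Real.log p + -(Real.log p / Real.log N) by
        rw [hσ]; ring, Real.exp_add, Real.exp_neg, Real.exp_log hp0, one_div]
    have e2 := Real.add_one_le_exp (-(Real.log p / Real.log N))
    have hp1 : 1 / (p : ℝ) ≤ 1 / 2 := one_div_le_one_div_of_le two_pos hp2
    have hp1' : 0 < 1 / (p : ℝ) := by positivity
    have hL : 0 ≤ Real.log p / Real.log N := div_nonneg (Real.log_natCast_nonneg p) hlogN.le
    have e3 := Real.add_one_le_exp (2 / Real.log N * (Real.log p / p))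
    have e4 : 2 / Real.log N * (Real.log p / p) = 2 * (1 / (p : ℝ)) * (Real.log p / Real.log N) := by
      ring
    rw [e4] at e3 ⊢
    rw [e1]
    set v := 1 / (p : ℝ)
    set w := Real.log p / Real.log N
    have e5 : (1 - v) * (2 * v * w + 1) ≤ (1 - v) * Real.exp (2 * v * w) :=
      mul_le_mul_of_nonneg_left e3 (by linarith)
    have e6 : v * (-w + 1) ≤ v * Real.exp (-w) := mul_le_mul_of_nonneg_left e2 hp1'.le
    have e7 : 0 ≤ v * w * (1 - 2 * v) := mul_nonneg (mul_nonneg hp1'.le hL) (by linarith)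
    nlinarith
  have hM : ∑ p ∈ N.primesBelow, 2 / Real.log N * (Real.log p / p) ≤ 6 := by
    rw [← mul_sum]
    have h1 : ∑ p ∈ N.primesBelow, Real.log p / p ≤ Real.log N + Real.log 4 := by
      refine le_trans (sum_le_sum_of_subset_of_nonneg (fun p hp => ?_) fun p _ _ => ?_)
        (sum_log_div_prime_le (by omega))
      · exact Nat.mem_primesLE.2 ⟨(Nat.lt_of_mem_primesBelow hp).le, Nat.prime_of_mem_primesBelow hp⟩
      · exact div_nonneg (Real.log_natCast_nonneg p) (Nat.cast_nonneg p)
    have h2 : Real.log 2 ≤ Real.log N := Real.log_le_log two_pos (by exact_mod_cast hN)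
    rw [log_four_eq] at h1
    rw [div_mul_eq_mul_div, div_le_iff₀ hlogN]
    linarith
  have hprod := prod_le_prod (fun p hp => (sub_pos.2 (hflt (Nat.prime_of_mem_primesBelow hp))).le) hpd
  rw [prod_mul_distrib, ← Real.exp_sum] at hprod
  have hVpos := prod_one_sub_inv_prime_pos N
  set V := ∏ p ∈ N.primesBelow, (1 - 1 / (p : ℝ))
  have hW : 1 / (3 * Real.log N) ≤ ∏ p ∈ N.primesBelow, (1 - (p : ℝ) ^ (-σ)) := by
    rw [prod_inv_distrib] at hz
    rw [one_div]
    exact (inv_le_comm₀ (prod_pos fun p hp => sub_pos.2 (hflt (Nat.prime_of_mem_primesBelow hp)))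
      (by positivity)).1 hz
  have h1 : 1 / (3 * Real.log N) ≤ V * Real.exp 6 :=
    hW.trans (hprod.trans (mul_le_mul_of_nonneg_left (Real.exp_le_exp.2 hM) hVpos.le))
  calc Real.exp (-6) / 3 / Real.log N = Real.exp (-6) * (1 / (3 * Real.log N)) := by
        field_simp
    _ ≤ Real.exp (-6) * (V * Real.exp 6) := mul_le_mul_of_nonneg_left h1 (Real.exp_pos _).le
    _ = V := by rw [mul_left_comm, ← Real.exp_add]; simp

/-- Omitting the primes of a finite set costs a bounded factor. -/
lemma prod_one_sub_inv_prime_diff_le {N : ℕ} (S : Finset ℕ) :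
    ∏ p ∈ N.primesBelow \ S, (1 - 1 / (p : ℝ)) ≤
      2 ^ S.card * ∏ p ∈ N.primesBelow, (1 - 1 / (p : ℝ)) := by
  have h1 : (1 / 2 : ℝ) ^ S.card ≤ ∏ p ∈ N.primesBelow ∩ S, (1 - 1 / (p : ℝ)) := by
    calc (1 / 2 : ℝ) ^ S.card ≤ (1 / 2) ^ (N.primesBelow ∩ S).card :=
          pow_le_pow_of_le_one (by norm_num) (by norm_num) (card_le_card inter_subset_right)
      _ = ∏ p ∈ N.primesBelow ∩ S, (1 / 2 : ℝ) := by simp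
      _ ≤ _ := prod_le_prod (fun _ _ => by norm_num) fun p hp => by
          have hp2 : (2 : ℝ) ≤ p := by
            exact_mod_cast Nat.two_le_of_mem_primesBelow (mem_inter.1 hp).1
          linarith [one_div_le_one_div_of_le two_pos hp2]
  have h0 : 0 ≤ ∏ p ∈ N.primesBelow \ S, (1 - 1 / (p : ℝ)) := prod_nonneg fun p hp => by
    have hp2 : (2 : ℝ) ≤ p := by exact_mod_cast Nat.two_le_of_mem_primesBelow (mem_sdiff.1 hp).1
    linarith [one_div_le_one_div_of_le two_pos hp2]
  rw [← prod_inter_mul_prod_sdiff N.primesBelow S]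
  have h2 := mul_le_mul_of_nonneg_left (mul_le_mul_of_nonneg_right h1 h0)
    (show (0 : ℝ) ≤ 2 ^ S.card by positivity)
  rwa [← mul_assoc, ← mul_pow, show (2 : ℝ) * (1 / 2) = 1 by norm_num, one_pow, one_mul] at h2

lemma sum_inv_sq_le_two (Q : Finset ℕ) (hQ : ∀ p ∈ Q, 0 < p) : ∑ p ∈ Q, 1 / (p : ℝ) ^ 2 ≤ 2 := by
  calc ∑ p ∈ Q, 1 / (p : ℝ) ^ 2 ≤ ∑ p ∈ Ioo 0 (Q.sup id + 1), 1 / (p : ℝ) ^ 2 := by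
        refine sum_le_sum_of_subset_of_nonneg (fun p hp => mem_Ioo.2 ⟨hQ p hp, ?_⟩)
          fun _ _ _ => by positivity
        exact Nat.lt_succ_of_le (le_sup (f := id) hp)
    _ ≤ 2 := by
        simp_rw [one_div]
        simpa using sum_Ioo_inv_sq_le (α := ℝ) 0 (Q.sup id + 1)

/-- The lower bound for the sieve density of dimension `k`. -/
lemma le_prod_one_sub_div_prime (k : ℕ) {N : ℕ} (hN : 2 ≤ N) {Q : Finset ℕ}
    (hQ : Q ⊆ N.primesBelow) (hQk : ∀ p ∈ Q, 2 * k < p) :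
    Real.exp (-4 * k ^ 2) * (Real.exp (-6) / 3) ^ k / Real.log N ^ k ≤
      ∏ p ∈ Q, (1 - (k : ℝ) / p) := by
  -- As `u = k / p ≤ 1 / 2`, one has `1 ≤ (1 - u) * exp (u + 2 * u ^ 2)`; the quadratic terms are
  -- summable, so dimension `k` costs only a constant over the `k`-th power.
  have hfac : ∀ p ∈ Q, (1 - 1 / (p : ℝ)) ^ k ≤
      (1 - (k : ℝ) / p) * Real.exp (2 * k ^ 2 * (1 / (p : ℝ) ^ 2)) := fun p hp => by
    have hpk : (2 * k : ℝ) < p := by exact_mod_cast hQk p hp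
    have hp2 : (2 : ℝ) ≤ p := by exact_mod_cast Nat.two_le_of_mem_primesBelow (hQ hp)
    have hp0 : (0 : ℝ) < p := by linarith
    set u := (k : ℝ) / p with hu
    have hu0 : 0 ≤ u := by positivity
    have hu1 : u ≤ 1 / 2 := by rw [hu, div_le_iff₀ hp0]; linarith
    have e1 : (1 - 1 / (p : ℝ)) ^ k ≤ Real.exp (-u) := by
      have := Real.add_one_le_exp (-(1 / (p : ℝ)))
      calc (1 - 1 / (p : ℝ)) ^ k ≤ Real.exp (-(1 / (p : ℝ))) ^ k := by
            refine pow_le_pow_left₀ ?_ (by linarith) k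
            linarith [one_div_le_one_div_of_le two_pos hp2]
        _ = Real.exp (-u) := by rw [← Real.exp_nat_mul, hu]; congr 1; ring
    have e2 : 1 ≤ (1 - u) * Real.exp (u + 2 * u ^ 2) := by
      have := Real.add_one_le_exp (u + 2 * u ^ 2)
      have h2 : (1 - u) * (u + 2 * u ^ 2 + 1) ≤ (1 - u) * Real.exp (u + 2 * u ^ 2) :=
        mul_le_mul_of_nonneg_left this (by linarith)
      have h3 : 0 ≤ u ^ 2 * (1 - 2 * u) := mul_nonneg (sq_nonneg u) (by linarith)
      nlinarith
    have e3 : 2 * k ^ 2 * (1 / (p : ℝ) ^ 2) = 2 * u ^ 2 := by rw [hu]; ring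
    rw [e3]
    calc (1 - 1 / (p : ℝ)) ^ k ≤ Real.exp (-u) * 1 := by rw [mul_one]; exact e1
      _ ≤ Real.exp (-u) * ((1 - u) * Real.exp (u + 2 * u ^ 2)) :=
          mul_le_mul_of_nonneg_left e2 (Real.exp_pos _).le
      _ = (1 - u) * Real.exp (2 * u ^ 2) := by
          rw [mul_left_comm, ← Real.exp_add]; congr 2; ring
  have hp01 : ∀ p ∈ N.primesBelow, 0 ≤ 1 - 1 / (p : ℝ) ∧ 1 - 1 / (p : ℝ) ≤ 1 := fun p hp => by
    have hp2 : (2 : ℝ) ≤ p := by exact_mod_cast Nat.two_le_of_mem_primesBelow hp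
    have : 0 ≤ 1 / (p : ℝ) := by positivity
    constructor <;> linarith [one_div_le_one_div_of_le two_pos hp2]
  have h1 := prod_le_prod (fun p hp => pow_nonneg (hp01 p (hQ hp)).1 k) hfac
  rw [prod_mul_distrib, ← Real.exp_sum, ← mul_sum, prod_pow] at h1
  have hV0 : 0 ≤ ∏ p ∈ Q, (1 - (k : ℝ) / p) := prod_nonneg fun p hp => by
    have hpk : (2 * k : ℝ) < p := by exact_mod_cast hQk p hp
    have hk0 : (0 : ℝ) ≤ k := Nat.cast_nonneg k
    rw [sub_nonneg, div_le_one (by linarith)]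
    linarith
  have h2 : ∏ p ∈ N.primesBelow, (1 - 1 / (p : ℝ)) ≤ ∏ p ∈ Q, (1 - 1 / (p : ℝ)) := by
    rw [← prod_sdiff hQ]
    refine mul_le_of_le_one_left (prod_nonneg fun p hp => (hp01 p (hQ hp)).1) ?_
    exact prod_le_one (fun p hp => (hp01 p (mem_sdiff.1 hp).1).1)
      fun p hp => (hp01 p (mem_sdiff.1 hp).1).2
  have h3 := le_prod_one_sub_inv_prime hN
  have hlogN : 0 < Real.log N := Real.log_pos (by exact_mod_cast hN)
  have h4 := pow_le_pow_left₀ (by positivity) (h3.trans h2) k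
  have h5 : Real.exp (2 * k ^ 2 * ∑ p ∈ Q, 1 / (p : ℝ) ^ 2) ≤ Real.exp (4 * k ^ 2) := by
    refine Real.exp_le_exp.2 ?_
    have := sum_inv_sq_le_two Q fun p hp => (Nat.prime_of_mem_primesBelow (hQ hp)).pos
    nlinarith [sq_nonneg (k : ℝ)]
  have h6 := (h4.trans h1).trans (mul_le_mul_of_nonneg_left h5 hV0)
  rw [div_pow] at h6
  calc _ = Real.exp (-4 * k ^ 2) * ((Real.exp (-6) / 3) ^ k / Real.log N ^ k) := by ring
    _ ≤ Real.exp (-4 * k ^ 2) * ((∏ p ∈ Q, (1 - (k : ℝ) / p)) * Real.exp (4 * k ^ 2)) :=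
        mul_le_mul_of_nonneg_left h6 (Real.exp_pos _).le
    _ = _ := by rw [mul_left_comm, ← Real.exp_add]; simp

/-! ### Truncation levels and the sieve bounds -/

/-- `4 * k` bounds the density sum of one block and `exp (-(8 * k))` bounds its sifting product from
below. Beyond `B` the first omitted Bonferroni term is thus a tiny fraction of that product. -/
lemma exists_pow_div_factorial_le (k : ℕ) : ∃ B : ℕ, 1 ≤ B ∧ ∀ m : ℕ, B ≤ m →
    (4 * k : ℝ) ^ m / m.factorial ≤ (1 / 2) ^ m * Real.exp (-(8 * k)) := by
  have h := FloorSemiring.tendsto_pow_div_factorial_atTop (8 * k : ℝ)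
  obtain ⟨B, hB⟩ := Filter.eventually_atTop.1
    (h.eventually_le_const (Real.exp_pos (-(8 * k : ℝ))))
  refine ⟨B + 1, by omega, fun m hm => ?_⟩
  have := hB m (by omega)
  calc (4 * k : ℝ) ^ m / m.factorial = (1 / 2) ^ m * ((8 * k : ℝ) ^ m / m.factorial) := by
        rw [← mul_div_assoc, ← mul_pow]; congr 2; ring
    _ ≤ _ := mul_le_mul_of_nonneg_left this (by positivity)

/-- This is the base-two exponent of the total remainder: truncation levels grow only linearly
towards smaller blocks while `2 ^ (j + 2)` decays geometrically, so the sum is of order `2 ^ t`. -/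
lemma sum_block_exponents_le (c t : ℕ) :
    ∑ j ∈ range t, 2 ^ (j + 2) * (c + 2 * (t - 1 - j)) ≤ 2 ^ (t + 2) * (c + 2) := by
  induction t with
  | zero => simp
  | succ t ih =>
    have h1 : ∑ j ∈ range t, 2 ^ (j + 2) * (c + 2 * (t + 1 - 1 - j)) =
        ∑ j ∈ range t, 2 ^ (j + 2) * (c + 2 * (t - 1 - j)) + 8 * ∑ j ∈ range t, 2 ^ j := by
      rw [mul_sum, ← sum_add_distrib]
      refine sum_congr rfl fun j hj => ?_
      rw [mem_range] at hj
      rw [show t + 1 - 1 - j = (t - 1 - j) + 1 by omega]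
      ring
    have h2 : ∑ j ∈ range t, 2 ^ j ≤ 2 ^ t := by
      have := Nat.geomSum_eq (m := 2) le_rfl t
      rw [this]; simp
    rw [sum_range_succ, h1]
    simp only [add_tsub_cancel_right, tsub_self, mul_zero, add_zero]
    ring_nf at ih h2 ⊢
    omega

lemma exists_block {p t : ℕ} (hp : 2 ≤ p) (hpt : p < 2 ^ 2 ^ t) :
    ∃ j < t, 2 ^ 2 ^ j ≤ p ∧ p < 2 ^ 2 ^ (j + 1) := by
  have hl : Nat.log 2 p ≠ 0 := by
    have := Nat.log_pos one_lt_two hp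
    omega
  have h1 : 2 ^ 2 ^ Nat.log 2 (Nat.log 2 p) ≤ p :=
    (Nat.pow_le_pow_right two_pos (Nat.pow_log_le_self 2 hl)).trans (Nat.pow_log_le_self 2 (by omega))
  refine ⟨Nat.log 2 (Nat.log 2 p), ?_, h1, ?_⟩
  · have h2 := h1.trans_lt hpt
    exact (Nat.pow_lt_pow_iff_right one_lt_two).1 ((Nat.pow_lt_pow_iff_right one_lt_two).1 h2)
  · exact (Nat.lt_pow_succ_log_self one_lt_two p).trans_le (Nat.pow_le_pow_right two_pos
      (Nat.lt_pow_succ_log_self one_lt_two _))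

/-- Upper and lower sieve bounds in dimension at most `k`, with an error that is a fixed power of
the sieving level `2 ^ 2 ^ t`. -/
theorem sieve_bounds (k : ℕ) : ∃ E : ℕ, ∀ (t : ℕ) (Q : Finset ℕ) (ρ : ℕ → ℕ),
    (∀ p ∈ Q, p.Prime) → (∀ p ∈ Q, 2 * k < p) → (∀ p ∈ Q, p < 2 ^ 2 ^ t) →
    (∀ p ∈ Q, ρ p ≤ k) → ∀ (A : Finset ℕ) (bad : ℕ → ℕ → Prop) [∀ p n, Decidable (bad p n)]
    (X : ℝ), 0 ≤ X →
    (∀ D ⊆ Q, |((A.filter fun n => ∀ p ∈ D, bad p n).card : ℝ) - X * ∏ p ∈ D, (ρ p / p : ℝ)| ≤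
      ∏ p ∈ D, (ρ p : ℝ)) →
    X * (∏ p ∈ Q, (1 - ρ p / p : ℝ)) / 2 - (2 ^ 2 ^ t) ^ E ≤
      ((A.filter fun n => ∀ p ∈ Q, ¬ bad p n).card : ℝ) ∧
    ((A.filter fun n => ∀ p ∈ Q, ¬ bad p n).card : ℝ) ≤
      2 * X * (∏ p ∈ Q, (1 - ρ p / p : ℝ)) + (2 ^ 2 ^ t) ^ E := by
  obtain ⟨B, hB1, hB⟩ := exists_pow_div_factorial_le k
  -- The multiple of four comes from `sum_block_exponents_le` with `c = 2 * B + 1`; the final `+ 1`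
  -- absorbs the factor `t + 1`.
  refine ⟨4 * (2 * B + 1 + 2) + 1, fun t Q ρ hQp hQk hQt hρ A bad _ X hX H => ?_⟩
  set g : ℕ → ℝ := fun p => if p ∈ Q then (ρ p / p : ℝ) else 0 with hg
  have hgQ : ∀ p ∈ Q, g p = ρ p / p := fun p hp => by simp [hg, hp]
  have hghalf : ∀ p, g p ≤ 1 / 2 := fun p => by
    by_cases hp : p ∈ Q
    · rw [hgQ p hp]
      have h1 : (2 * k : ℝ) < p := by exact_mod_cast hQk p hp
      have h2 : (ρ p : ℝ) ≤ k := by exact_mod_cast hρ p hp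
      have h3 : (0 : ℝ) < p := by exact_mod_cast (hQp p hp).pos
      rw [div_le_iff₀ h3]; linarith
    · simp [hg, hp]
  have hg0 : ∀ p, 0 ≤ g p := fun p => by
    simp only [hg]; split_ifs <;> positivity
  set R : ℕ → Finset ℕ := fun j => Q.filter fun p => 2 ^ 2 ^ j ≤ p ∧ p < 2 ^ 2 ^ (j + 1) with hR
  have hU : (range t).biUnion R = Q := by
    ext p
    simp only [hR, mem_biUnion, mem_range, mem_filter]
    constructor
    · rintro ⟨_, _, h, _⟩; exact h
    · intro hp
      obtain ⟨j, hj, h⟩ := exists_block (hQp p hp).two_le (hQt p hp)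
      exact ⟨j, hj, hp, h⟩
  have hdisj : ∀ i ∈ range t, ∀ j ∈ range t, i ≠ j → Disjoint (R i) (R j) := by
    intro i _ j _ hij
    rw [disjoint_left]
    intro p hpi hpj
    simp only [hR, mem_filter] at hpi hpj
    have e1 := hpi.2.1.trans_lt hpj.2.2
    have e2 := hpj.2.1.trans_lt hpi.2.2
    rw [Nat.pow_lt_pow_iff_right one_lt_two, Nat.pow_lt_pow_iff_right one_lt_two] at e1 e2
    omega
  -- Even, and two higher for each step down from the top block, so that the `δ j = (1 / 2) ^ (b j +
  -- 1)` sum to at most `1 / 2`.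
  set b : ℕ → ℕ := fun j => 2 * B + 2 * (t - 1 - j) with hb
  have hS : ∀ j, ∑ p ∈ R j, g p ≤ 4 * k := fun j => by
    have := sum_inv_prime_block_le j (Q := R j) (fun p hp => hQp p (mem_filter.1 hp).1)
      (fun p hp => (mem_filter.1 hp).2.1) (fun p hp => (mem_filter.1 hp).2.2)
    calc ∑ p ∈ R j, g p ≤ ∑ p ∈ R j, k * ((1 : ℝ) / p) := sum_le_sum fun p hp => by
          rw [hgQ p (mem_filter.1 hp).1, mul_one_div]
          exact div_le_div_of_nonneg_right (by exact_mod_cast hρ p (mem_filter.1 hp).1)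
            (Nat.cast_nonneg p)
      _ ≤ 4 * k := by
          rw [← mul_sum]
          nlinarith [(Nat.cast_nonneg k : (0 : ℝ) ≤ k)]
  have hV : ∀ j, Real.exp (-(8 * k)) ≤ ∏ p ∈ R j, (1 - g p) := fun j => by
    calc Real.exp (-(8 * k)) ≤ Real.exp (∑ p ∈ R j, -(2 * g p)) := by
          rw [Real.exp_le_exp, sum_neg_distrib, ← mul_sum]
          linarith [hS j]
      _ = ∏ p ∈ R j, Real.exp (-(2 * g p)) := Real.exp_sum _ _
      _ ≤ _ := prod_le_prod (fun _ _ => (Real.exp_pos _).le) fun p _ => by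
          have h1 := Real.add_one_le_exp (2 * g p)
          have h2 : 1 ≤ (1 - g p) * Real.exp (2 * g p) := by
            have h3 := mul_le_mul_of_nonneg_left h1
              (show 0 ≤ 1 - g p by linarith [hghalf p])
            nlinarith [mul_nonneg (hg0 p) (show 0 ≤ 1 - 2 * g p by linarith [hghalf p])]
          rw [Real.exp_neg, inv_eq_one_div, div_le_iff₀ (Real.exp_pos _)]
          exact h2
  have hδ : ∀ j ∈ range t, cardSum (sizeInd (b j + 1)) (R j) g ≤
      (1 / 2) ^ (b j + 1) * ∏ p ∈ R j, (1 - g p) := fun j _ =>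
    calc cardSum (sizeInd (b j + 1)) (R j) g ≤ (∑ p ∈ R j, g p) ^ (b j + 1) / (b j + 1).factorial :=
          cardSum_sizeInd_le (fun p _ => hg0 p) _
      _ ≤ (4 * k : ℝ) ^ (b j + 1) / (b j + 1).factorial := by
          gcongr
          exact hS j
      _ ≤ (1 / 2) ^ (b j + 1) * Real.exp (-(8 * k)) := hB _ (by simp only [hb]; omega)
      _ ≤ _ := mul_le_mul_of_nonneg_left (hV j) (by positivity)
  have hδs : ∑ j ∈ range t, (1 / 2 : ℝ) ^ (b j + 1) ≤ 1 / 2 := by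
    have h1 := sum_range_reflect (fun i => (1 / 2 : ℝ) ^ (2 * B + 2 * i + 1)) t
    simp only [hb]
    rw [h1]
    calc ∑ i ∈ range t, (1 / 2 : ℝ) ^ (2 * B + 2 * i + 1) ≤
          ∑ i ∈ range t, (1 / 4) * (1 / 2 : ℝ) ^ i := sum_le_sum fun i _ => by
            rw [show (1 / 4 : ℝ) * (1 / 2) ^ i = (1 / 2) ^ (2 + i) by rw [pow_add]; norm_num]
            exact pow_le_pow_of_le_one (by norm_num) (by norm_num) (by omega)
      _ ≤ 1 / 2 := by
          rw [← mul_sum]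
          linarith [sum_geometric_two_le t]
  have hcard : ∀ D : Finset ℕ, ∑ n ∈ A, ∏ p ∈ D, (if bad p n then (1 : ℝ) else 0) =
      (A.filter fun n => ∀ p ∈ D, bad p n).card := fun D => by
    simp_rw [prod_ite_zero, prod_const_one]
    rw [sum_boole]
  have hcard' : ∑ n ∈ A, ∏ p ∈ Q, (1 - (if bad p n then (1 : ℝ) else 0)) =
      (A.filter fun n => ∀ p ∈ Q, ¬ bad p n).card := by
    have e : ∀ n p, (1 - (if bad p n then (1 : ℝ) else 0)) = if ¬ bad p n then 1 else 0 :=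
      fun n p => by by_cases h : bad p n <;> simp [h]
    simp_rw [e, prod_ite_zero, prod_const_one]
    rw [sum_boole]
  have main := brun_hooley A (fun n p => if bad p n then (1 : ℝ) else 0) hX g (fun p => (ρ p : ℝ)) R
    (range t) b (fun j => (1 / 2) ^ (b j + 1)) (fun n p => by split_ifs <;> simp)
    (fun n p => by split_ifs <;> simp) hg0 (fun p => (hghalf p).trans (by norm_num))
    (fun p => Nat.cast_nonneg _) (fun D hD => by
      rw [hU] at hD
      rw [hcard, prod_congr rfl fun p hp => hgQ p (hD hp)]
      exact H D hD) hdisj (fun j => by simp only [hb]; exact ⟨B + (t - 1 - j), by ring⟩)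
    (fun j _ => by positivity) hδ hδs
  rw [hU, hcard', prod_congr rfl fun p hp => by rw [hgQ p hp], card_range] at main
  -- A nonempty block forces `2 * k < 2 ^ 2 ^ (j + 1)`, so `k` times the block length, plus one, is
  -- at most the square of `2 ^ 2 ^ (j + 1)`.
  have hM : ∀ j, 1 + ∑ p ∈ R j, (ρ p : ℝ) ≤ 2 ^ 2 ^ (j + 2) := fun j => by
    have h1 : (∑ p ∈ R j, ρ p) ≤ (R j).card * k :=
      sum_le_card_nsmul _ _ _ fun p hp => hρ p (mem_filter.1 hp).1
    have h2 : (R j).card ≤ 2 ^ 2 ^ (j + 1) := by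
      have : R j ⊆ range (2 ^ 2 ^ (j + 1)) := fun p hp => mem_range.2 (mem_filter.1 hp).2.2
      simpa using card_le_card this
    have h3 : 1 + ∑ p ∈ R j, ρ p ≤ 2 ^ 2 ^ (j + 2) := by
      rcases (R j).eq_empty_or_nonempty with h | ⟨p, hp⟩
      · rw [h]; simp; exact Nat.one_le_two_pow
      · have h4 := (hQk p (mem_filter.1 hp).1).trans (mem_filter.1 hp).2.2
        have h5 : 2 ^ 2 ^ (j + 2) = 2 ^ 2 ^ (j + 1) * 2 ^ 2 ^ (j + 1) := by
          rw [← pow_add]; congr 1; ring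
        rw [h5]
        have h6 : 2 ≤ 2 ^ 2 ^ (j + 1) := by
          calc 2 = 2 ^ 1 := rfl
            _ ≤ _ := Nat.pow_le_pow_right two_pos Nat.one_le_two_pow
        have h7 := Nat.mul_le_mul_right k h2
        nlinarith
    exact_mod_cast h3
  have hErr : ((t : ℝ) + 1) * ∏ j ∈ range t, (1 + ∑ p ∈ R j, (ρ p : ℝ)) ^ (b j + 1) ≤
      (2 ^ 2 ^ t) ^ (4 * (2 * B + 1 + 2) + 1) := by
    have h1 : ∏ j ∈ range t, (1 + ∑ p ∈ R j, (ρ p : ℝ)) ^ (b j + 1) ≤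
        (2 ^ 2 ^ t) ^ (4 * (2 * B + 1 + 2)) := by
      calc _ ≤ ∏ j ∈ range t, ((2 : ℝ) ^ 2 ^ (j + 2)) ^ (b j + 1) := by
            refine prod_le_prod (fun j _ => by positivity) fun j _ => ?_
            exact pow_le_pow_left₀ (by positivity) (hM j) _
        _ = 2 ^ ∑ j ∈ range t, 2 ^ (j + 2) * (2 * B + 1 + 2 * (t - 1 - j)) := by
            rw [← prod_pow_eq_pow_sum]
            refine prod_congr rfl fun j _ => ?_
            rw [← pow_mul]
            simp only [hb]
            congr 2; ring
        _ ≤ 2 ^ (2 ^ (t + 2) * (2 * B + 1 + 2)) :=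
            pow_le_pow_right₀ one_le_two (sum_block_exponents_le _ _)
        _ = _ := by rw [← pow_mul]; congr 1; ring
    have h2 : (t : ℝ) + 1 ≤ 2 ^ 2 ^ t := by
      have h3 : t + 1 ≤ 2 ^ t := Nat.lt_two_pow_self
      have h4 : 2 ^ t ≤ 2 ^ 2 ^ t := Nat.lt_two_pow_self.le
      exact_mod_cast h3.trans h4
    rw [pow_succ, mul_comm]
    exact mul_le_mul h1 h2 (by positivity) (by positivity)
  constructor <;> linarith [main.1, main.2]

/-! ### Residue classes and roots of the linear forms -/

/-- The Chinese remainder theorem for the number of common residues. -/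
lemma card_filter_range_prod {bad : ℕ → ℕ → Prop} [∀ p n, Decidable (bad p n)]
    (hper : ∀ p n, bad p n ↔ bad p (n % p)) {D : Finset ℕ} (hD : ∀ p ∈ D, p.Prime) :
    ((range (∏ p ∈ D, p)).filter fun n => ∀ p ∈ D, bad p n).card =
      ∏ p ∈ D, ((range p).filter (bad p)).card := by
  induction D using Finset.induction_on with
  | empty => simp
  | insert q D hq ih =>
    have hD' : ∀ p ∈ D, p.Prime := fun p hp => hD p (mem_insert_of_mem hp)
    have hqp := hD q (mem_insert_self q D)
    rw [prod_insert hq, prod_insert hq, ← ih hD', ← card_product]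
    set d := ∏ p ∈ D, p with hd
    have hd0 : 0 < d := prod_pos fun p hp => (hD' p hp).pos
    have hco : q.Coprime d := Nat.Coprime.prod_right fun p hp =>
      (Nat.coprime_primes hqp (hD' p hp)).2 fun h => hq (h ▸ hp)
    have hmod : ∀ n, ∀ p ∈ D, bad p (n % d) ↔ bad p n := fun n p hp => by
      rw [hper p (n % d), Nat.mod_mod_of_dvd n (dvd_prod_of_mem _ hp), ← hper]
    refine card_nbij (fun n => (n % q, n % d)) (fun n hn => ?_) (fun m hm n hn h => ?_)
      fun x hx => ?_
    · simp only [coe_filter, mem_range, Set.mem_ofPred_eq, forall_mem_insert] at hn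
      refine mem_product.2 ⟨mem_filter.2 ⟨mem_range.2 ?_, ?_⟩, mem_filter.2 ⟨mem_range.2 ?_, ?_⟩⟩
      exacts [Nat.mod_lt _ hqp.pos, (hper q n).1 hn.2.1, Nat.mod_lt _ hd0,
        fun p hp => (hmod n p hp).2 (hn.2.2 p hp)]
    · simp only [coe_filter, mem_range, Set.mem_ofPred_eq] at hm hn
      simp only [Prod.mk.injEq] at h
      have := (Nat.modEq_and_modEq_iff_modEq_mul hco).1 ⟨h.1, h.2⟩
      exact this.eq_of_lt_of_lt hm.1 hn.1
    · simp only [coe_product, coe_filter, mem_range, Set.mem_prod, Set.mem_ofPred_eq] at hx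
      obtain ⟨y, hy1, hy2⟩ := Nat.chineseRemainder hco x.1 x.2
      have e1 : y % (q * d) % q = x.1 := by
        rw [Nat.mod_mod_of_dvd _ (dvd_mul_right q d), hy1, Nat.mod_eq_of_lt hx.1.1]
      have e2 : y % (q * d) % d = x.2 := by
        rw [Nat.mod_mod_of_dvd _ (dvd_mul_left d q), hy2, Nat.mod_eq_of_lt hx.2.1]
      refine ⟨y % (q * d), ?_, Prod.ext e1 e2⟩
      simp only [coe_filter, mem_range, Set.mem_ofPred_eq, forall_mem_insert]
      refine ⟨Nat.mod_lt _ (Nat.mul_pos hqp.pos hd0), ?_, fun p hp => ?_⟩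
      · rw [hper, e1]; exact hx.1.2
      · rw [← hmod _ p hp, e2]; exact hx.2.2 p hp

/-- The number of `n < N` in given residue classes modulo the primes of `D`. -/
lemma abs_card_residues_sub_le {bad : ℕ → ℕ → Prop} [∀ p n, Decidable (bad p n)]
    (hper : ∀ p n, bad p n ↔ bad p (n % p)) {D : Finset ℕ} (hD : ∀ p ∈ D, p.Prime) {ρ : ℕ → ℕ}
    (hρ : ∀ p ∈ D, ((range p).filter (bad p)).card = ρ p) (N : ℕ) :
    |(((range N).filter fun n => ∀ p ∈ D, bad p n).card : ℝ) - N * ∏ p ∈ D, (ρ p / p : ℝ)| ≤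
      ∏ p ∈ D, (ρ p : ℝ) := by
  set d := ∏ p ∈ D, p with hd
  have hd0 : 0 < d := prod_pos fun p hp => (hD p hp).pos
  set C := (range d).filter fun n => ∀ p ∈ D, bad p n with hC
  have hCcard : (C.card : ℝ) = ∏ p ∈ D, (ρ p : ℝ) := by
    rw [card_filter_range_prod hper hD, prod_congr rfl hρ]; push_cast; rfl
  have hmem : ∀ n ∈ (range N).filter (fun n => ∀ p ∈ D, bad p n), n % d ∈ C := fun n hn => by
    rw [hC, mem_filter, mem_range]
    refine ⟨Nat.mod_lt _ hd0, fun p hp => ?_⟩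
    rw [hper p (n % d), Nat.mod_mod_of_dvd n (dvd_prod_of_mem _ hp), ← hper]
    exact (mem_filter.1 hn).2 p hp
  have hfib : ∀ c ∈ C, |((((range N).filter fun n => ∀ p ∈ D, bad p n).filter
      fun n => n % d = c).card : ℝ) - N / d| ≤ 1 := fun c hc => by
    rw [hC, mem_filter, mem_range] at hc
    have e : ((range N).filter fun n => ∀ p ∈ D, bad p n).filter (fun n => n % d = c) =
        (range N).filter (· ≡ c [MOD d]) := by
      ext n
      simp only [mem_filter, mem_range, Nat.ModEq, Nat.mod_eq_of_lt hc.1]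
      constructor
      · rintro ⟨⟨h1, _⟩, h2⟩; exact ⟨h1, h2⟩
      · rintro ⟨h1, h2⟩
        refine ⟨⟨h1, fun p hp => ?_⟩, h2⟩
        have e3 := Nat.mod_mod_of_dvd n (dvd_prod_of_mem (fun p => p) hp)
        rw [hper p n, ← e3, ← hd, h2, ← hper]
        exact hc.2 p hp
    rw [e, ← Nat.count_eq_card_filter_range, Nat.count_modEq_card _ hd0]
    have hd0' : (0 : ℝ) < d := by exact_mod_cast hd0
    have h1 : ((N / d : ℕ) : ℝ) ≤ N / d := Nat.cast_div_le
    have h2 : (N : ℝ) / d < ((N / d : ℕ) : ℝ) + 1 := by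
      rw [← Nat.floor_div_eq_div (K := ℝ)]
      exact Nat.lt_floor_add_one _
    rw [abs_le]
    push_cast
    split_ifs
    · norm_num; constructor <;> linarith
    · norm_num; constructor <;> linarith
  rw [card_eq_sum_card_fiberwise (f := fun n => n % d) (t := C) (fun n hn => hmem n hn)]
  have hprod : (N : ℝ) * ∏ p ∈ D, (ρ p / p : ℝ) = ∑ c ∈ C, (N / d : ℝ) := by
    rw [sum_const, nsmul_eq_mul, hCcard, prod_div_distrib, hd]
    push_cast
    ring
  rw [hprod]
  push_cast
  rw [← sum_sub_distrib]
  calc _ ≤ ∑ c ∈ C, (1 : ℝ) := (abs_sum_le_sum_abs _ _).trans (sum_le_sum hfib)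
    _ = _ := by simp [hCcard]

namespace SieveHypotheses

variable {k : ℕ} {S : Finset ℕ} {a b : Fin k → ℤ}

lemma not_dvd_coeff (H : SieveHypotheses S a b) {p : ℕ} (hp : p.Prime) (hpS : p ∉ S) (i : Fin k) :
    ¬ (p : ℤ) ∣ a i := fun h => hpS (H.coeff_unit i p hp h)

lemma two_mul_lt (H : SieveHypotheses S a b) {p : ℕ} (hp : p.Prime) (hpS : p ∉ S) : 2 * k < p := by
  by_contra! h
  exact hpS (H.small_primes p hp h)

/-- The determinant is the combination `a i * L j (n) - a j * L i (n)`, so a common prime divisor of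
two distinct forms lies in `S`. -/
lemma eq_of_dvd_linForm (H : SieveHypotheses S a b) {p : ℕ} (hp : p.Prime) (hpS : p ∉ S)
    {i j : Fin k} {n : ℕ} (hi : (p : ℤ) ∣ linForm a b i n) (hj : (p : ℤ) ∣ linForm a b j n) :
    i = j := by
  by_contra hij
  refine hpS (H.det_unit i j hij p hp ?_)
  have : a i * b j - a j * b i = a i * linForm a b j n - a j * linForm a b i n := by
    unfold linForm; ring
  rw [this]
  exact dvd_sub (hj.mul_left _) (hi.mul_left _)

/-- Along a progression whose modulus is prime to `p`, a linear form has exactly one root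
modulo `p`. -/
lemma exists_root (H : SieveHypotheses S a b) {p : ℕ} (hp : p.Prime) (hpS : p ∉ S) {q : ℕ}
    (hq : ¬ p ∣ q) (r : ℕ) (i : Fin k) :
    ∃ m < p, ∀ m' < p, (p : ℤ) ∣ linForm a b i (r + q * m') ↔ m' = m := by
  have := Fact.mk hp
  have ha : ((a i * q : ℤ) : ZMod p) ≠ 0 := by
    rw [Ne, ZMod.intCast_zmod_eq_zero_iff_dvd]
    intro h
    rcases (Nat.prime_iff_prime_int.1 hp).dvd_or_dvd h with h | h
    · exact H.not_dvd_coeff hp hpS i h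
    · exact hq (by exact_mod_cast h)
  set x : ZMod p := -((a i * r + b i : ℤ) : ZMod p) / ((a i * q : ℤ) : ZMod p) with hx
  refine ⟨x.val, ZMod.val_lt x, fun m' hm' => ?_⟩
  rw [← ZMod.intCast_zmod_eq_zero_iff_dvd]
  have e : ((linForm a b i (r + q * m') : ℤ) : ZMod p) =
      ((a i * q : ℤ) : ZMod p) * (m' : ZMod p) + ((a i * r + b i : ℤ) : ZMod p) := by
    unfold linForm; push_cast; ring
  rw [e]
  have e2 : m' = x.val ↔ (m' : ZMod p) = x := by
    constructor
    · rintro rfl; simp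
    · intro h; rw [← h, ZMod.val_natCast, Nat.mod_eq_of_lt hm']
  rw [e2, hx, eq_div_iff ha, eq_neg_iff_add_eq_zero, mul_comm]

/-- Each form has one root modulo `p`, and distinct forms have distinct roots, so the local density
is exactly the number of sieved forms. -/
lemma card_roots (H : SieveHypotheses S a b) {p : ℕ} (hp : p.Prime) (hpS : p ∉ S) {q : ℕ}
    (hq : ¬ p ∣ q) (r : ℕ) (I : Finset (Fin k)) :
    ((range p).filter fun m => (p : ℤ) ∣ ∏ i ∈ I, linForm a b i (r + q * m)).card = I.card := by
  choose f hf1 hf2 using H.exists_root hp hpS hq r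
  have : ((range p).filter fun m => (p : ℤ) ∣ ∏ i ∈ I, linForm a b i (r + q * m)) = I.image f := by
    ext m
    rw [mem_filter, mem_range, (Nat.prime_iff_prime_int.1 hp).dvd_finsetProd_iff, mem_image]
    constructor
    · rintro ⟨hm, i, hi, h⟩
      exact ⟨i, hi, ((hf2 i m hm).1 h).symm⟩
    · rintro ⟨i, hi, rfl⟩
      exact ⟨hf1 i, i, hi, (hf2 i _ (hf1 i)).2 rfl⟩
  rw [this, card_image_of_injective]
  intro i j hij
  exact H.eq_of_dvd_linForm hp hpS ((hf2 i _ (hf1 i)).2 rfl)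
    (by rw [hij]; exact (hf2 j _ (hf1 j)).2 rfl)

end SieveHypotheses

lemma dvd_prod_linForm_mod {k : ℕ} (a b : Fin k → ℤ) (I : Finset (Fin k)) (r q p n : ℕ) :
    (p : ℤ) ∣ ∏ i ∈ I, linForm a b i (r + q * n) ↔
      (p : ℤ) ∣ ∏ i ∈ I, linForm a b i (r + q * (n % p)) := by
  rw [← ZMod.intCast_zmod_eq_zero_iff_dvd, ← ZMod.intCast_zmod_eq_zero_iff_dvd]
  simp [linForm]

/-- The sieve for the values of linear forms along a progression, where at the prime `p` only the
forms with indices in `I p` are sieved. -/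
theorem linForm_sieve (k : ℕ) : ∃ E : ℕ, ∀ (t : ℕ) (S : Finset ℕ) (a b : Fin k → ℤ),
    SieveHypotheses S a b → ∀ (Q : Finset ℕ) (I : ℕ → Finset (Fin k)) (N r q : ℕ),
    (∀ p ∈ Q, p.Prime) → (∀ p ∈ Q, p ∉ S) → (∀ p ∈ Q, p < 2 ^ 2 ^ t) → (∀ p ∈ Q, ¬ p ∣ q) →
    N * (∏ p ∈ Q, (1 - (I p).card / p : ℝ)) / 2 - (2 ^ 2 ^ t) ^ E ≤
      (((range N).filter fun m => ∀ p ∈ Q,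
        ¬ (p : ℤ) ∣ ∏ i ∈ I p, linForm a b i (r + q * m)).card : ℝ) ∧
    (((range N).filter fun m => ∀ p ∈ Q,
        ¬ (p : ℤ) ∣ ∏ i ∈ I p, linForm a b i (r + q * m)).card : ℝ) ≤
      2 * N * (∏ p ∈ Q, (1 - (I p).card / p : ℝ)) + (2 ^ 2 ^ t) ^ E := by
  obtain ⟨E, hE⟩ := sieve_bounds k
  refine ⟨E, fun t S a b H Q I N r q hQp hQS hQt hQq => ?_⟩
  exact hE t Q (fun p => (I p).card) hQp (fun p hp => H.two_mul_lt (hQp p hp) (hQS p hp)) hQt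
    (fun p _ => by simpa using card_le_univ (I p)) (range N)
    (fun p m => (p : ℤ) ∣ ∏ i ∈ I p, linForm a b i (r + q * m)) N (Nat.cast_nonneg N)
    fun D hD => abs_card_residues_sub_le (fun p n => dvd_prod_linForm_mod a b (I p) r q p n)
      (fun p hp => hQp p (hD hp))
      (fun p hp => H.card_roots (hQp p (hD hp)) (hQS p (hD hp)) (hQq p (hD hp)) r (I p)) N

/-! ### Lower and upper bounds for sifted linear forms -/

/-- For the least admissible `t > 0`, `2 ^ 2 ^ (t - 1) < ⌈z⌉₊ ≤ z ^ 2`; squaring gives the bound.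
Errors polynomial in the level thus become polynomial in `z`. -/
lemma exists_level {z : ℝ} (hz : 2 ≤ z) :
    ∃ t : ℕ, ⌈z⌉₊ ≤ 2 ^ 2 ^ t ∧ ((2 : ℝ) ^ 2 ^ t) ≤ z ^ 4 := by
  have hex : ∃ t : ℕ, ⌈z⌉₊ ≤ 2 ^ 2 ^ t :=
    ⟨⌈z⌉₊, (Nat.lt_two_pow_self.le.trans Nat.lt_two_pow_self.le)⟩
  have hc : (⌈z⌉₊ : ℝ) ≤ z ^ 2 := by
    have := Nat.ceil_lt_add_one (show 0 ≤ z by linarith)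
    nlinarith
  refine ⟨Nat.find hex, Nat.find_spec hex, ?_⟩
  rcases Nat.eq_zero_or_pos (Nat.find hex) with h | h
  · rw [h]
    have h2 : (2 : ℝ) ^ 4 ≤ z ^ 4 := by gcongr
    norm_num at h2 ⊢
    linarith
  · have hlt := Nat.find_min hex (Nat.sub_lt h one_pos)
    rw [not_le] at hlt
    have e : 2 ^ Nat.find hex = 2 ^ (Nat.find hex - 1) * 2 := by
      rw [← pow_succ]; congr 1; omega
    have h1 : (2 : ℝ) ^ 2 ^ (Nat.find hex - 1) ≤ z ^ 2 := le_trans (by exact_mod_cast hlt.le) hc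
    rw [e, pow_mul]
    calc _ ≤ (z ^ 2) ^ 2 := pow_le_pow_left₀ (by positivity) h1 2
      _ = _ := by ring

lemma dvd_sievePrimorial_iff {S : Finset ℕ} {z : ℝ} {m : ℤ} :
    Int.gcd m (sievePrimorial S z) = 1 ↔ ∀ p ∈ Nat.primesBelow ⌈z⌉₊ \ S, ¬ (p : ℤ) ∣ m := by
  have e : sievePrimorial S z = ∏ p ∈ Nat.primesBelow ⌈z⌉₊ \ S, p := by
    unfold sievePrimorial
    congr 1
    ext p
    simp only [mem_filter, mem_range, mem_sdiff, Nat.mem_primesBelow, and_assoc]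
  have hp : ∀ p ∈ Nat.primesBelow ⌈z⌉₊ \ S, p.Prime := fun p hp =>
    Nat.prime_of_mem_primesBelow (mem_sdiff.1 hp).1
  rw [e, Int.gcd_eq_natAbs, Int.natAbs_natCast, ← Nat.coprime_iff_gcd_eq_one, Nat.coprime_prod_right_iff]
  refine forall₂_congr fun p hpm => ?_
  rw [Nat.coprime_comm, (hp p hpm).coprime_iff_not_dvd, Int.natCast_dvd]

lemma mem_sieveOmega {k : ℕ} {S : Finset ℕ} {a b : Fin k → ℤ} {x z : ℝ} {n : ℕ} :
    n ∈ sieveOmega S a b x z ↔ (1 ≤ n ∧ n ≤ ⌊x⌋₊) ∧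
      ∀ p : ℕ, p.Prime → (p : ℝ) < z → p ∉ S → ∀ i, ¬ (p : ℤ) ∣ linForm a b i n := by
  unfold sieveOmega
  rw [mem_filter, mem_Icc, dvd_sievePrimorial_iff]
  refine and_congr_right fun _ => ?_
  simp only [mem_sdiff, Nat.mem_primesBelow, Nat.lt_ceil]
  constructor
  · intro h p hp hz hS i hi
    exact h p ⟨⟨hz, hp⟩, hS⟩ (hi.trans (dvd_prod_of_mem _ (mem_univ i)))
  · rintro h p ⟨⟨hz, hp⟩, hS⟩ hd
    obtain ⟨i, -, hi⟩ := ((Nat.prime_iff_prime_int.1 hp).dvd_finsetProd_iff _).1 hd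
    exact h p hp hz hS i hi

lemma two_le_ceil {z : ℝ} (hz : 2 ≤ z) : 2 ≤ ⌈z⌉₊ := by
  have := Nat.ceil_mono hz
  simpa using this

lemma log_ceil_le {z : ℝ} (hz : 2 ≤ z) : Real.log ⌈z⌉₊ ≤ 2 * Real.log z := by
  have hc : (⌈z⌉₊ : ℝ) ≤ z ^ 2 := by
    have := Nat.ceil_lt_add_one (show 0 ≤ z by linarith)
    nlinarith
  have h0 : (0 : ℝ) < ⌈z⌉₊ := by
    have := two_le_ceil hz
    positivity
  calc Real.log ⌈z⌉₊ ≤ Real.log (z ^ 2) := Real.log_le_log h0 hc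
    _ = _ := by rw [Real.log_pow]; norm_num

lemma log_pos_of_two_le {z : ℝ} (hz : 2 ≤ z) : 0 < Real.log z := Real.log_pos (by linarith)

/-- The lower bound of the sieve for `Ω(x, z)`. -/
lemma le_card_sieveOmega (k : ℕ) : ∃ (c : ℝ) (E : ℕ), 0 < c ∧ ∀ (S : Finset ℕ) (a b : Fin k → ℤ),
    SieveHypotheses S a b → ∀ x z : ℝ, 2 ≤ x → 2 ≤ z →
      c * (x / Real.log z ^ k) - z ^ E ≤ (sieveOmega S a b x z).card := by
  obtain ⟨E, hE⟩ := linForm_sieve k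
  -- The divisor `2 ^ k` pays for `log ⌈z⌉₊ ≤ 2 * log z`, and `4` for the sieve's factor `1 / 2`
  -- together with `⌊x⌋₊ ≥ x / 2`.
  refine ⟨Real.exp (-4 * k ^ 2) * (Real.exp (-6) / 3) ^ k / 2 ^ k / 4, 4 * E, by positivity,
    fun S a b H x z hx hz => ?_⟩
  obtain ⟨t, ht1, ht2⟩ := exists_level hz
  set Q := Nat.primesBelow ⌈z⌉₊ \ S with hQ
  have hQp : ∀ p ∈ Q, p.Prime := fun p hp => Nat.prime_of_mem_primesBelow (mem_sdiff.1 hp).1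
  have hQS : ∀ p ∈ Q, p ∉ S := fun p hp => (mem_sdiff.1 hp).2
  have h1 := (hE t S a b H Q (fun _ => univ) ⌊x⌋₊ 1 1 hQp hQS
    (fun p hp => (Nat.lt_of_mem_primesBelow (mem_sdiff.1 hp).1).trans_le ht1)
    (fun p hp h => (hQp p hp).one_lt.ne' (Nat.dvd_one.1 h))).1
  have h2 : (((range ⌊x⌋₊).filter fun m => ∀ p ∈ Q,
        ¬ (p : ℤ) ∣ ∏ i : Fin k, linForm a b i (1 + 1 * m)).card) ≤ (sieveOmega S a b x z).card := by
    refine card_le_card_of_injOn (fun m => 1 + 1 * m) (fun m hm => ?_) (fun m _ n _ h => by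
      simpa using h)
    rw [mem_coe, mem_filter, mem_range] at hm
    unfold sieveOmega
    rw [mem_coe, mem_filter, mem_Icc, dvd_sievePrimorial_iff]
    exact ⟨⟨Nat.le_add_right _ _, by have := hm.1; dsimp only; omega⟩, hm.2⟩
  have h3 := le_prod_one_sub_div_prime k (two_le_ceil hz) (Q := Q) sdiff_subset
    (fun p hp => H.two_mul_lt (hQp p hp) (hQS p hp))
  simp only [card_univ, Fintype.card_fin] at h1
  set c := Real.exp (-4 * k ^ 2) * (Real.exp (-6) / 3) ^ k with hc
  have hc0 : 0 < c := by positivity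
  have hlz := log_pos_of_two_le hz
  have hlc : 0 < Real.log ⌈z⌉₊ := Real.log_pos (by exact_mod_cast two_le_ceil hz)
  have h4 : c / 2 ^ k / Real.log z ^ k ≤ ∏ p ∈ Q, (1 - (k : ℝ) / p) := by
    refine le_trans ?_ h3
    rw [div_div, ← mul_pow]
    have := log_ceil_le hz
    gcongr
  have h5 : x / 2 ≤ ⌊x⌋₊ := by
    have := Nat.lt_floor_add_one x
    linarith
  have h6 : ((2 : ℝ) ^ 2 ^ t) ^ E ≤ z ^ (4 * E) := by
    rw [pow_mul]; exact pow_le_pow_left₀ (by positivity) ht2 E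
  have h7 : x / 2 * (c / 2 ^ k / Real.log z ^ k) ≤ ⌊x⌋₊ * ∏ p ∈ Q, (1 - (k : ℝ) / p) :=
    mul_le_mul h5 h4 (by positivity) (Nat.cast_nonneg _)
  have h8 : c / 2 ^ k / 4 * (x / Real.log z ^ k) = x / 2 * (c / 2 ^ k / Real.log z ^ k) / 2 := by
    ring
  rw [h8]
  have h9 : ((((range ⌊x⌋₊).filter fun m => ∀ p ∈ Q,
        ¬ (p : ℤ) ∣ ∏ i : Fin k, linForm a b i (1 + 1 * m)).card : ℕ) : ℝ) ≤
      (sieveOmega S a b x z).card := by exact_mod_cast h2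
  linarith

/-- An upper bound sieve for the values of linear forms along a progression, where all forms are
sieved by the primes below `z`, and the form of index `i` by the primes below `y`. -/
lemma card_le_of_sifted (k : ℕ) : ∃ E : ℕ, ∀ (S : Finset ℕ) (a b : Fin k → ℤ),
    SieveHypotheses S a b → ∀ (i : Fin k) (y z : ℝ) (N r q : ℕ) (A : Finset ℕ),
    2 ≤ z → z ≤ y → A ⊆ range N →
    (∀ p : ℕ, p.Prime → (p : ℝ) < y → p ∉ S → ¬ p ∣ q) →
    (∀ m ∈ A, ∀ p : ℕ, p.Prime → (p : ℝ) < z → p ∉ S → ∀ j,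
      ¬ (p : ℤ) ∣ linForm a b j (r + q * m)) →
    (∀ m ∈ A, ∀ p : ℕ, p.Prime → (p : ℝ) < y → p ∉ S → ¬ (p : ℤ) ∣ linForm a b i (r + q * m)) →
    (A.card : ℝ) ≤
      2 * 2 ^ (S.card * k) * (N / (Real.log z ^ (k - 1) * Real.log y)) + y ^ E := by
  obtain ⟨E, hE⟩ := linForm_sieve k
  refine ⟨4 * E, fun S a b H i y z N r q A hz hzy hAN hq hAz hAy => ?_⟩
  have hy : 2 ≤ y := hz.trans hzy
  obtain ⟨t, ht1, ht2⟩ := exists_level hy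
  set Q := Nat.primesBelow ⌈y⌉₊ \ S with hQ
  have hQp : ∀ p ∈ Q, p.Prime := fun p hp => Nat.prime_of_mem_primesBelow (mem_sdiff.1 hp).1
  have hQS : ∀ p ∈ Q, p ∉ S := fun p hp => (mem_sdiff.1 hp).2
  have hQy : ∀ p ∈ Q, (p : ℝ) < y := fun p hp =>
    Nat.lt_ceil.1 (Nat.lt_of_mem_primesBelow (mem_sdiff.1 hp).1)
  -- Dimension `k` below `z` and dimension one between `z` and `y`; Bernoulli's inequality then
  -- splits the density into `k - 1` products up to `z` and one up to `y`.
  set I : ℕ → Finset (Fin k) := fun p => if p < ⌈z⌉₊ then univ else {i} with hI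
  have h1 := (hE t S a b H Q I N r q hQp hQS
    (fun p hp => (Nat.lt_of_mem_primesBelow (mem_sdiff.1 hp).1).trans_le ht1)
    (fun p hp => hq p (hQp p hp) (hQy p hp) (hQS p hp))).2
  have h2 : A.card ≤ ((range N).filter fun m => ∀ p ∈ Q,
        ¬ (p : ℤ) ∣ ∏ i ∈ I p, linForm a b i (r + q * m)).card := by
    refine card_le_card fun m hm => mem_filter.2 ⟨hAN hm, fun p hp hd => ?_⟩
    obtain ⟨j, hj, hdj⟩ := ((Nat.prime_iff_prime_int.1 (hQp p hp)).dvd_finsetProd_iff _).1 hd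
    simp only [hI] at hj
    split_ifs at hj with hpz
    · exact hAz m hm p (hQp p hp) (Nat.lt_ceil.1 hpz) (hQS p hp) j hdj
    · rw [mem_singleton] at hj
      rw [hj] at hdj
      exact hAy m hm p (hQp p hp) (hQy p hp) (hQS p hp) hdj
  have hk : k - 1 + 1 = k := by have := i.pos; omega
  have hp1 : ∀ p ∈ Q, 0 ≤ 1 - 1 / (p : ℝ) := fun p hp => by
    have hp2 : (2 : ℝ) ≤ p := by exact_mod_cast (hQp p hp).two_le
    linarith [one_div_le_one_div_of_le two_pos hp2]
  have h3 : ∏ p ∈ Q, (1 - ((I p).card : ℝ) / p) ≤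
      (∏ p ∈ Nat.primesBelow ⌈z⌉₊ \ S, (1 - 1 / (p : ℝ))) ^ (k - 1) *
        ∏ p ∈ Q, (1 - 1 / (p : ℝ)) := by
    have e : ∏ p ∈ Nat.primesBelow ⌈z⌉₊ \ S, (1 - 1 / (p : ℝ)) =
        ∏ p ∈ Q, if p < ⌈z⌉₊ then (1 - 1 / (p : ℝ)) else 1 := by
      rw [← prod_filter]
      refine prod_congr ?_ fun _ _ => rfl
      ext p
      have := Nat.ceil_mono hzy
      simp only [hQ, mem_sdiff, mem_filter, Nat.mem_primesBelow]
      constructor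
      · rintro ⟨⟨h1, h2⟩, h3⟩; exact ⟨⟨⟨by omega, h2⟩, h3⟩, h1⟩
      · rintro ⟨⟨⟨_, h2⟩, h3⟩, h1⟩; exact ⟨⟨h1, h2⟩, h3⟩
    rw [e, ← prod_pow, ← prod_mul_distrib]
    refine prod_le_prod (fun p hp => ?_) fun p hp => ?_
    · have h4 := H.two_mul_lt (hQp p hp) (hQS p hp)
      have h5 : (I p).card ≤ k := by simpa using card_le_univ (I p)
      have h6 : ((I p).card : ℝ) ≤ p := by exact_mod_cast (by omega : (I p).card ≤ p)
      rw [sub_nonneg]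
      exact div_le_one_of_le₀ h6 (Nat.cast_nonneg p)
    · simp only [hI]
      split_ifs with h
      · rw [← pow_succ, hk]
        have h4 := one_add_mul_le_pow (a := -(1 / (p : ℝ))) (by linarith [hp1 p hp]) k
        rw [card_univ, Fintype.card_fin]
        calc 1 - (k : ℝ) / p = 1 + k * -(1 / (p : ℝ)) := by ring
          _ ≤ _ := h4
          _ = _ := by rw [← sub_eq_add_neg]
      · simp
  have hlz := log_pos_of_two_le hz
  have hly := log_pos_of_two_le hy
  have hV : ∀ w : ℝ, 2 ≤ w → ∏ p ∈ Nat.primesBelow ⌈w⌉₊ \ S, (1 - 1 / (p : ℝ)) ≤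
      2 ^ S.card * (1 / Real.log w) := fun w hw => by
    refine (prod_one_sub_inv_prime_diff_le S).trans (mul_le_mul_of_nonneg_left ?_ (by positivity))
    refine (prod_one_sub_inv_prime_le (two_le_ceil hw)).trans
      (one_div_le_one_div_of_le (log_pos_of_two_le hw) ?_)
    exact Real.log_le_log (by linarith) (Nat.le_ceil w)
  have hVz0 : 0 ≤ ∏ p ∈ Nat.primesBelow ⌈z⌉₊ \ S, (1 - 1 / (p : ℝ)) := prod_nonneg fun p hp => by
    have hp2 : (2 : ℝ) ≤ p := by
      exact_mod_cast (Nat.prime_of_mem_primesBelow (mem_sdiff.1 hp).1).two_le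
    linarith [one_div_le_one_div_of_le two_pos hp2]
  have h4 : ∏ p ∈ Q, (1 - ((I p).card : ℝ) / p) ≤
      2 ^ (S.card * k) * (1 / (Real.log z ^ (k - 1) * Real.log y)) := by
    refine h3.trans ?_
    calc _ ≤ (2 ^ S.card * (1 / Real.log z)) ^ (k - 1) * (2 ^ S.card * (1 / Real.log y)) :=
          mul_le_mul (pow_le_pow_left₀ hVz0 (hV z hz) _) (hV y hy) (prod_nonneg hp1)
            (by positivity)
      _ = (2 ^ S.card) ^ (k - 1 + 1) * (1 / (Real.log z ^ (k - 1) * Real.log y)) := by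
          rw [mul_pow, pow_succ, div_pow, one_pow]
          field_simp
      _ = _ := by rw [hk, pow_mul]
  have h6 : ((2 : ℝ) ^ 2 ^ t) ^ E ≤ y ^ (4 * E) := by
    rw [pow_mul]; exact pow_le_pow_left₀ (by positivity) ht2 E
  have h7 := mul_le_mul_of_nonneg_left h4 (show (0 : ℝ) ≤ 2 * N by positivity)
  have h8 : (A.card : ℝ) ≤ (((range N).filter fun m => ∀ p ∈ Q,
        ¬ (p : ℤ) ∣ ∏ i ∈ I p, linForm a b i (r + q * m)).card : ℕ) := by exact_mod_cast h2
  calc (A.card : ℝ) ≤ 2 * N * (2 ^ (S.card * k) * (1 / (Real.log z ^ (k - 1) * Real.log y))) +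
        y ^ (4 * E) := by linarith
    _ = _ := by ring

/-! ### Exceptional values and existence of sieving constants -/

lemma exists_log_pow_le_rpow (k : ℕ) (K : ℝ) {δ : ℝ} (hδ : 0 < δ) :
    ∃ X : ℝ, 2 ≤ X ∧ ∀ x : ℝ, X ≤ x → K * Real.log x ^ k ≤ x ^ δ := by
  have h := ((isLittleO_log_rpow_rpow_atTop k hδ).const_mul_left K).bound one_pos
  obtain ⟨X, hX⟩ := Filter.eventually_atTop.1 h
  refine ⟨max X 2, le_max_right _ _, fun x hx => ?_⟩
  have h1 := hX x ((le_max_left _ _).trans hx)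
  have h2 : (2 : ℝ) ≤ x := (le_max_right _ _).trans hx
  rw [one_mul, Real.rpow_natCast, Real.norm_of_nonneg (Real.rpow_nonneg (by linarith) _)] at h1
  exact (Real.le_norm_self _).trans h1

/-- Induction on `|m|`: if `m` is not squarefree, a prime whose square divides it lies in `S`, and
one factor of it can be moved into the unit part. -/
lemma isSigmaSquarefree_of_forall_prime {S : Finset ℕ} :
    ∀ {m : ℤ}, m ≠ 0 → (∀ p : ℕ, p.Prime → p ∉ S → ¬ (p : ℤ) ^ 2 ∣ m) → IsSigmaSquarefree S m := by
  suffices h : ∀ (N : ℕ) (m : ℤ), m.natAbs = N → m ≠ 0 →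
      (∀ p : ℕ, p.Prime → p ∉ S → ¬ (p : ℤ) ^ 2 ∣ m) → IsSigmaSquarefree S m by
    intro m hm hp
    exact h _ m rfl hm hp
  intro N
  induction N using Nat.strong_induction_on with
  | _ N ih =>
    intro m hN hm hp
    by_cases hsq : Squarefree m
    · refine ⟨1, m, fun p hp h => ?_, hsq, (one_mul m).symm⟩
      exact absurd (Int.natCast_dvd.1 h) hp.not_dvd_one
    · rw [← Int.squarefree_natAbs, Nat.squarefree_iff_prime_squarefree] at hsq
      push Not at hsq
      obtain ⟨p, hpp, hpm⟩ := hsq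
      have hpm' : (p : ℤ) ^ 2 ∣ m := by
        rw [← Int.dvd_natAbs, pow_two]; exact_mod_cast hpm
      have hpS : p ∈ S := by
        by_contra h; exact hp p hpp h hpm'
      obtain ⟨m', rfl⟩ := (dvd_pow_self (p : ℤ) two_ne_zero).trans hpm'
      have hm' : m' ≠ 0 := right_ne_zero_of_mul hm
      obtain ⟨u, v, hu, hv, e⟩ := ih m'.natAbs (by
        rw [← hN, Int.natAbs_mul, Int.natAbs_natCast]
        exact lt_mul_of_one_lt_left (Int.natAbs_pos.2 hm') hpp.one_lt) m' rfl hm'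
        fun q hq hqS h => hp q hq hqS (h.mul_left _)
      refine ⟨p * u, v, fun q hq h => ?_, hv, by rw [e]; ring⟩
      rcases (Nat.prime_iff_prime_int.1 hq).dvd_or_dvd h with h | h
      · have := (Nat.prime_dvd_prime_iff_eq hq hpp).1 (by exact_mod_cast h)
        exact this ▸ hpS
      · exact hu q hq h

/-- A nonconstant form is injective, and its values here lie among the integers of absolute value at
most `⌊y⌋₊`. -/
lemma card_abs_linForm_lt_le {k : ℕ} {a b : Fin k → ℤ} {i : Fin k} (ha : a i ≠ 0) (A : Finset ℕ)
    {y : ℝ} (hy : 0 ≤ y) (hA : ∀ n ∈ A, ((linForm a b i n).natAbs : ℝ) < y) :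
    (A.card : ℝ) ≤ 2 * y + 1 := by
  have h : A.card ≤ (Icc (-(⌊y⌋₊ : ℤ)) ⌊y⌋₊).card := by
    refine card_le_card_of_injOn (linForm a b i) (fun n hn => ?_) fun m _ n _ h => ?_
    · have := Nat.le_floor (hA n hn).le
      rw [mem_coe, mem_Icc]
      omega
    · unfold linForm at h
      have h1 := add_right_cancel h
      exact_mod_cast mul_left_cancel₀ ha h1
  rw [Int.card_Icc] at h
  have h2 : (A.card : ℝ) ≤ 2 * (⌊y⌋₊ : ℝ) + 1 := by
    have : A.card ≤ 2 * ⌊y⌋₊ + 1 := by omega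
    exact_mod_cast this
  linarith [Nat.floor_le hy]

lemma card_le_of_modEq {A : Finset ℕ} {d X : ℕ} (hX : ∀ n ∈ A, n ≤ X)
    (hmod : ∀ m ∈ A, ∀ n ∈ A, m ≡ n [MOD d]) : (A.card : ℝ) ≤ (X : ℝ) / d + 1 := by
  have h : A.card ≤ (range (X / d + 1)).card := by
    refine card_le_card_of_injOn (· / d) (fun n hn => ?_) fun m hm n hn h => ?_
    · rw [mem_coe, mem_range]
      exact Nat.lt_succ_of_le (Nat.div_le_div_right (hX n hn))
    · rw [← Nat.div_add_mod m d, ← Nat.div_add_mod n d, hmod m hm n hn]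
      dsimp only at h
      rw [h]
  rw [card_range] at h
  have h2 : (A.card : ℝ) ≤ ((X / d : ℕ) : ℝ) + 1 := by exact_mod_cast h
  linarith [(Nat.cast_div_le : ((X / d : ℕ) : ℝ) ≤ X / d)]

/-- A bound for the coefficients of a system of linear forms. -/
def coeffBound {k : ℕ} (a b : Fin k → ℤ) : ℝ := ∑ i, (|a i| + |b i| : ℝ)

lemma coeffBound_nonneg {k : ℕ} (a b : Fin k → ℤ) : 0 ≤ coeffBound a b :=
  sum_nonneg fun _ _ => by positivity

lemma natAbs_linForm_le {k : ℕ} (a b : Fin k → ℤ) (i : Fin k) {n : ℕ} {x : ℝ} (hx : 1 ≤ x)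
    (hn : (n : ℝ) ≤ x) : ((linForm a b i n).natAbs : ℝ) ≤ coeffBound a b * x := by
  have h1 : (|a i| + |b i| : ℝ) ≤ coeffBound a b :=
    single_le_sum (f := fun i => (|a i| + |b i| : ℝ)) (fun i _ => by positivity) (mem_univ i)
  rw [Nat.cast_natAbs]
  unfold linForm
  push_cast
  calc |(a i : ℝ) * n + b i| ≤ |(a i : ℝ) * n| + |(b i : ℝ)| := abs_add_le _ _
    _ = |(a i : ℝ)| * n + |(b i : ℝ)| * 1 := by rw [abs_mul, Nat.abs_cast, mul_one]
    _ ≤ |(a i : ℝ)| * x + |(b i : ℝ)| * x := by gcongr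
    _ = (|a i| + |b i| : ℝ) * x := by push_cast; ring
    _ ≤ _ := mul_le_mul_of_nonneg_right h1 (by linarith)

/-- The number of `n ≤ x` for which `L i (n)` is divisible by the square of a large prime. -/
lemma card_sq_dvd_linForm_le {k : ℕ} {S : Finset ℕ} {a b : Fin k → ℤ} (H : SieveHypotheses S a b)
    (i : Fin k) {x z : ℝ} (hx : 1 ≤ x) (hz : 2 ≤ z) (A : Finset ℕ) (hAx : ∀ n ∈ A, n ≤ ⌊x⌋₊)
    (hA0 : ∀ n ∈ A, linForm a b i n ≠ 0)
    (hA : ∀ n ∈ A, ∃ p : ℕ, p.Prime ∧ p ∉ S ∧ z ≤ p ∧ (p : ℤ) ^ 2 ∣ linForm a b i n) :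
    (A.card : ℝ) ≤ 2 * (x / z) + Real.sqrt (coeffBound a b) * Real.sqrt x := by
  -- A square `p ^ 2` dividing a nonzero value forces `p ≤ R`, so the `+ 1` per residue class costs
  -- only order `√x` in total.
  set R := ⌊Real.sqrt (coeffBound a b * x)⌋₊ with hR
  set T := (Ioo (⌈z⌉₊ - 1) (R + 1)).filter fun p => p.Prime ∧ p ∉ S with hT
  have hc := two_le_ceil hz
  have hcov : A ⊆ T.biUnion fun p => A.filter fun n => (p : ℤ) ^ 2 ∣ linForm a b i n := by
    intro n hn
    obtain ⟨p, hp, hpS, hpz, hpd⟩ := hA n hn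
    rw [mem_biUnion]
    refine ⟨p, mem_filter.2 ⟨mem_Ioo.2 ⟨?_, ?_⟩, hp, hpS⟩, mem_filter.2 ⟨hn, hpd⟩⟩
    · have := Nat.ceil_le.2 hpz
      omega
    · have h1 : (p : ℝ) ^ 2 ≤ (linForm a b i n).natAbs := by
        have h2 := Int.natAbs_dvd_natAbs.2 hpd
        rw [Int.natAbs_pow, Int.natAbs_natCast] at h2
        exact_mod_cast Nat.le_of_dvd (Int.natAbs_pos.2 (hA0 n hn)) h2
      have h3 : (n : ℝ) ≤ x := (Nat.le_floor_iff (by linarith)).1 (hAx n hn)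
      exact Nat.lt_succ_of_le (Nat.le_floor (Real.le_sqrt_of_sq_le
        (h1.trans (natAbs_linForm_le a b i hx h3))))
  have hone : ∀ p ∈ T, ((A.filter fun n => (p : ℤ) ^ 2 ∣ linForm a b i n).card : ℝ) ≤
      x * ((p : ℝ) ^ 2)⁻¹ + 1 := fun p hp => by
    obtain ⟨-, hpp, hpS⟩ := mem_filter.1 hp
    have h := card_le_of_modEq (A := A.filter fun n => (p : ℤ) ^ 2 ∣ linForm a b i n)
      (d := p ^ 2) (X := ⌊x⌋₊) (fun n hn => hAx n (mem_filter.1 hn).1) fun m hm n hn => by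
        have h1 := dvd_sub (mem_filter.1 hn).2 (mem_filter.1 hm).2
        have e : linForm a b i n - linForm a b i m = a i * ((n : ℤ) - m) := by
          unfold linForm; ring
        rw [e] at h1
        have hco : IsCoprime ((p : ℤ) ^ 2) (a i) := IsCoprime.pow_left
          ((Prime.coprime_iff_not_dvd (Nat.prime_iff_prime_int.1 hpp)).2 (H.not_dvd_coeff hpp hpS i))
        have h2 := hco.dvd_of_dvd_mul_left h1
        rw [Nat.modEq_iff_dvd]
        exact_mod_cast h2
    refine h.trans ?_
    rw [div_eq_mul_inv]
    push_cast
    have := Nat.floor_le (show 0 ≤ x by linarith)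
    gcongr
  have hTI : T ⊆ Ioo (⌈z⌉₊ - 1) (R + 1) := filter_subset _ _
  have hsum : ∑ p ∈ T, ((p : ℝ) ^ 2)⁻¹ ≤ 2 / z := by
    calc ∑ p ∈ T, ((p : ℝ) ^ 2)⁻¹ ≤ ∑ p ∈ Ioo (⌈z⌉₊ - 1) (R + 1), ((p : ℝ) ^ 2)⁻¹ :=
          sum_le_sum_of_subset_of_nonneg hTI fun _ _ _ => by positivity
      _ ≤ 2 / ((⌈z⌉₊ - 1 : ℕ) + 1) := sum_Ioo_inv_sq_le _ _
      _ ≤ 2 / z := by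
          have h1 : (((⌈z⌉₊ - 1 : ℕ) : ℝ) + 1) = ⌈z⌉₊ := by
            rw [← Nat.cast_succ]; congr 1; omega
          rw [h1]
          have := Nat.le_ceil z
          gcongr
  have hTcard : (T.card : ℝ) ≤ Real.sqrt (coeffBound a b) * Real.sqrt x := by
    rw [← Real.sqrt_mul (coeffBound_nonneg a b)]
    have h1 : T.card ≤ R := (card_le_card hTI).trans (by rw [Nat.card_Ioo]; omega)
    have h2 : (R : ℝ) ≤ Real.sqrt (coeffBound a b * x) := Nat.floor_le (Real.sqrt_nonneg _)
    exact le_trans (by exact_mod_cast h1) h2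
  calc (A.card : ℝ) ≤ ∑ p ∈ T, ((A.filter fun n => (p : ℤ) ^ 2 ∣ linForm a b i n).card : ℝ) := by
        exact_mod_cast (card_le_card hcov).trans card_biUnion_le
    _ ≤ ∑ p ∈ T, (x * ((p : ℝ) ^ 2)⁻¹ + 1) := sum_le_sum hone
    _ = x * ∑ p ∈ T, ((p : ℝ) ^ 2)⁻¹ + T.card := by
        rw [sum_add_distrib, ← mul_sum]; simp
    _ ≤ x * (2 / z) + Real.sqrt (coeffBound a b) * Real.sqrt x := by gcongr
    _ = _ := by ring

open Classical in
/-- The elements of `Ω(x, z)` outside `Ω₁(x, z)` have a form with a small value, a value divisible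
by the square of a large prime, or a large prime value. -/
lemma sieveOmega_subset {k : ℕ} {S : Finset ℕ} {a b : Fin k → ℤ} (x y z : ℝ) (hy : 1 < y) :
    sieveOmega S a b x z ⊆ sieveOmegaOne S a b x z ∪ univ.biUnion fun i =>
      ((sieveOmega S a b x z).filter fun n => ((linForm a b i n).natAbs : ℝ) < y) ∪
      (((sieveOmega S a b x z).filter fun n => linForm a b i n ≠ 0 ∧
        ∃ p : ℕ, p.Prime ∧ p ∉ S ∧ z ≤ p ∧ (p : ℤ) ^ 2 ∣ linForm a b i n) ∪
      ((sieveOmega S a b x z).filter fun n => (linForm a b i n).natAbs.Prime ∧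
        y ≤ (linForm a b i n).natAbs)) := by
  intro n hn
  by_contra hcon
  simp only [mem_union, mem_biUnion, mem_univ, true_and, mem_filter, hn, not_or, not_exists,
    not_lt] at hcon
  obtain ⟨h1, h2⟩ := hcon
  refine h1 ?_
  unfold sieveOmegaOne
  refine mem_filter.2 ⟨hn, fun i => ?_⟩
  obtain ⟨h3, h4, h5⟩ := h2 i
  have h6 : (1 : ℝ) < (linForm a b i n).natAbs := hy.trans_le h3
  have h7 : 1 < (linForm a b i n).natAbs := by exact_mod_cast h6
  have h0 : linForm a b i n ≠ 0 := fun h => by rw [h] at h7; simp at h7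
  refine ⟨isSigmaSquarefree_of_forall_prime h0 fun p hp hpS hd => ?_, h7, fun hp => h5 ⟨hp, h3⟩⟩
  refine h4 ⟨h0, p, hp, hpS, ?_, hd⟩
  by_contra hpz
  exact (mem_sieveOmega.1 hn).2 p hp (not_le.1 hpz) hpS i ((dvd_pow_self _ two_ne_zero).trans hd)

/-- Sieving constants exist. -/
theorem exists_areSievingConstants (k s : ℕ) (hk : 0 < k) :
    ∃ η c₁ : ℝ, AreSievingConstants k s η c₁ := by
  classical
  obtain ⟨c, E₁, hc, hlow⟩ := le_card_sieveOmega k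
  obtain ⟨E₂, hup⟩ := card_le_of_sifted k
  -- The upper sieve depends on `S` only through its size, which makes the constants uniform.
  set C : ℝ := 2 * 2 ^ (s * k) with hC
  have hk0 : (0 : ℝ) < k := by exact_mod_cast hk
  set η₀ : ℝ := 1 / (2 * (E₂ + 1)) with hη₀
  have hη₀0 : 0 < η₀ := by positivity
  have hη₀1 : η₀ ≤ 1 / 2 := by
    rw [hη₀]; apply one_div_le_one_div_of_le two_pos; linarith [(Nat.cast_nonneg E₂ : (0 : ℝ) ≤ E₂)]
  have hη₀E : η₀ * E₂ ≤ 1 / 2 := by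
    rw [hη₀, div_mul_eq_mul_div, div_le_iff₀ (by positivity)]; linarith
  -- The three bounds ensure `z ≤ y`, `z ^ E₁ ≤ √x`, and `k * C * η / η₀ ≤ c / 4`, the last limiting
  -- the loss from prime values.
  set η : ℝ := min η₀ (min (1 / (2 * (E₁ + 1))) (c * η₀ / (4 * k * C))) with hη
  have hη0 : 0 < η := by
    refine lt_min hη₀0 (lt_min (by positivity) (by positivity))
  have hηη₀ : η ≤ η₀ := min_le_left _ _
  have hηE : η * E₁ ≤ 1 / 2 := by
    have h1 : η ≤ 1 / (2 * (E₁ + 1)) := (min_le_right _ _).trans (min_le_left _ _)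
    calc η * E₁ ≤ 1 / (2 * (E₁ + 1)) * E₁ := mul_le_mul_of_nonneg_right h1 (Nat.cast_nonneg _)
      _ ≤ 1 / 2 := by rw [div_mul_eq_mul_div, div_le_iff₀ (by positivity)]; linarith
  have hηc : η * (4 * k * C) ≤ c * η₀ := by
    rw [← le_div_iff₀ (by positivity)]
    exact (min_le_right _ _).trans (min_le_right _ _)
  refine ⟨η, min (c / 2) (1 / 2), ⟨hη0, hηη₀.trans hη₀1⟩,
    ⟨lt_min (by positivity) (by norm_num), min_le_right _ _⟩, fun a b => ?_⟩
  -- `K` collects all multiples of `√x`: one from the lower sieve, and for each form three from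
  -- small values, one from the upper sieve and `√(coeffBound a b)` from square divisors.
  set K : ℝ := 1 + 4 * k + k * Real.sqrt (coeffBound a b) with hK
  obtain ⟨X₁, hX₁, hX₁'⟩ := exists_log_pow_le_rpow k (8 / c * (2 * k)) one_pos
  obtain ⟨X₂, hX₂, hX₂'⟩ := exists_log_pow_le_rpow k (8 / c * K) (δ := 1 / 2) (by norm_num)
  refine ⟨max X₁ X₂, hX₁.trans (le_max_left _ _), fun S hS H x z hx hz hzx => ?_⟩
  have hz2 : 2 ≤ z := (hX₁.trans (le_max_left _ _)).trans hz
  have hx1 : 1 ≤ x := by linarith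
  have hx0 : 0 < x := by linarith
  have hzx' : z ≤ x := hzx.trans (by
    simpa using Real.rpow_le_rpow_of_exponent_le hx1 (by linarith : η ≤ 1))
  set y := x ^ η₀ with hy
  have hzy : z ≤ y := hzx.trans (Real.rpow_le_rpow_of_exponent_le hx1 hηη₀)
  have hlz := log_pos_of_two_le hz2
  have hlx := log_pos_of_two_le hx
  have hlzx : Real.log z ≤ η * Real.log x := by
    rw [← Real.log_rpow hx0]; exact Real.log_le_log (by linarith) hzx
  have hly : Real.log y = η₀ * Real.log x := Real.log_rpow hx0 _
  set w := Real.sqrt x with hw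
  have hwr : w = x ^ (1 / 2 : ℝ) := Real.sqrt_eq_rpow x
  have hw1 : 1 ≤ w := Real.one_le_sqrt.2 hx1
  have hyw : y ≤ w := by rw [hwr]; exact Real.rpow_le_rpow_of_exponent_le hx1 hη₀1
  have hpow : ∀ (u θ : ℝ) (E : ℕ), 0 ≤ u → u ≤ x ^ θ → θ * E ≤ 1 / 2 → u ^ E ≤ w := by
    intro u θ E hu0 hu hθ
    calc u ^ E ≤ (x ^ θ) ^ E := pow_le_pow_left₀ hu0 hu E
      _ = x ^ (θ * E) := by rw [Real.rpow_mul_natCast hx0.le]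
      _ ≤ w := by rw [hwr]; exact Real.rpow_le_rpow_of_exponent_le hx1 hθ
  have hzE : z ^ E₁ ≤ w := hpow z η E₁ (by linarith) hzx hηE
  have hyE : y ^ E₂ ≤ w := hpow y η₀ E₂ (by linarith) le_rfl hη₀E
  set T := x / Real.log z ^ k with hT
  have hT0 : 0 < T := by positivity
  set Om := sieveOmega S a b x z with hOm
  have hOmx : ∀ n ∈ Om, 1 ≤ n ∧ n ≤ ⌊x⌋₊ := fun n hn => (mem_sieveOmega.1 hn).1
  have b1 : ∀ i, ((Om.filter fun n => ((linForm a b i n).natAbs : ℝ) < y).card : ℝ) ≤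
      3 * w := fun i => by
    have := card_abs_linForm_lt_le (H.coeff_ne_zero i) (b := b)
      (Om.filter fun n => ((linForm a b i n).natAbs : ℝ) < y) (y := y) (by linarith)
      fun n hn => (mem_filter.1 hn).2
    linarith
  have b2 : ∀ i, ((Om.filter fun n => linForm a b i n ≠ 0 ∧
        ∃ p : ℕ, p.Prime ∧ p ∉ S ∧ z ≤ p ∧ (p : ℤ) ^ 2 ∣ linForm a b i n).card : ℝ) ≤
      2 * (x / z) + Real.sqrt (coeffBound a b) * w := fun i =>
    card_sq_dvd_linForm_le H i hx1 hz2 _ (fun n hn => (hOmx n (mem_filter.1 hn).1).2)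
      (fun n hn => (mem_filter.1 hn).2.1) fun n hn => (mem_filter.1 hn).2.2
  have b3 : ∀ i, ((Om.filter fun n => (linForm a b i n).natAbs.Prime ∧
        y ≤ (linForm a b i n).natAbs).card : ℝ) ≤ c / (4 * k) * T + w := fun i => by
    set A := Om.filter fun n => (linForm a b i n).natAbs.Prime ∧
        y ≤ (linForm a b i n).natAbs with hA
    have hmem : ∀ m ∈ A.image (· - 1), 1 + 1 * m ∈ A ∧ m < ⌊x⌋₊ := fun m hm => by
      obtain ⟨n, hn, rfl⟩ := mem_image.1 hm
      have h1 := hOmx n (mem_filter.1 hn).1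
      have e : 1 + 1 * (n - 1) = n := by omega
      exact ⟨by rwa [e], by omega⟩
    have hcard : (A.image (· - 1)).card = A.card := card_image_of_injOn fun m hm n hn h => by
      have h1 := hOmx m (mem_filter.1 hm).1
      have h2 := hOmx n (mem_filter.1 hn).1
      omega
    have h := hup S a b H i y z ⌊x⌋₊ 1 1 (A.image (· - 1)) hz2 hzy
      (fun m hm => mem_range.2 (hmem m hm).2) (fun p hp _ _ h => hp.one_lt.ne' (Nat.dvd_one.1 h))
      (fun m hm p hp hpz hpS j =>
        (mem_sieveOmega.1 (mem_filter.1 (hmem m hm).1).1).2 p hp hpz hpS j)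
      (fun m hm p hp hpy hpS hd => by
        obtain ⟨h1, h2⟩ := (mem_filter.1 (hmem m hm).1).2
        have h3 := (Nat.prime_dvd_prime_iff_eq hp h1).1 (Int.natCast_dvd.1 hd)
        rw [← h3] at h2
        linarith)
    rw [hcard, hS, ← hC] at h
    have h1 : (⌊x⌋₊ : ℝ) / (Real.log z ^ (k - 1) * Real.log y) ≤ η / η₀ * T := by
      have e : η / η₀ * T = x / (Real.log z ^ (k - 1) * (η₀ * (Real.log z / η))) := by
        rw [hT]
        obtain ⟨k', rfl⟩ : ∃ k', k = k' + 1 := ⟨k - 1, by omega⟩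
        rw [Nat.add_sub_cancel, pow_succ]
        field_simp
      rw [e, hly]
      have h2 : Real.log z / η ≤ Real.log x := by rw [div_le_iff₀ hη0]; linarith
      have h3 := Nat.floor_le hx0.le
      gcongr
    have h2 : C * (η / η₀ * T) ≤ c / (4 * k) * T := by
      rw [← mul_assoc]
      refine mul_le_mul_of_nonneg_right ?_ hT0.le
      rw [le_div_iff₀ (by positivity), mul_div_assoc', div_mul_eq_mul_div, div_le_iff₀ hη₀0]
      linarith
    have h3 := mul_le_mul_of_nonneg_left h1 (show 0 ≤ C by positivity)
    linarith
  have hcount : (Om.card : ℝ) ≤ (sieveOmegaOne S a b x z).card +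
      k * (3 * w + (2 * (x / z) + Real.sqrt (coeffBound a b) * w + (c / (4 * k) * T + w))) := by
    have h1 := (card_le_card (sieveOmega_subset (S := S) (a := a) (b := b) x y z
      (by linarith))).trans ((card_union_le _ _).trans (Nat.add_le_add_left card_biUnion_le _))
    have h2 : (Om.card : ℝ) ≤ (sieveOmegaOne S a b x z).card + ∑ i : Fin k,
        (3 * w + (2 * (x / z) + Real.sqrt (coeffBound a b) * w + (c / (4 * k) * T + w))) := by
      refine (Nat.cast_le.2 h1).trans ?_
      rw [Nat.cast_add, Nat.cast_sum]
      refine add_le_add le_rfl (sum_le_sum fun i _ => ?_)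
      have h3 : ∀ A B C : Finset ℕ, ((A ∪ (B ∪ C)).card : ℝ) ≤ A.card + (B.card + C.card) :=
        fun A B C => by
          exact_mod_cast (card_union_le _ _).trans (Nat.add_le_add_left (card_union_le _ _) _)
      refine (h3 _ _ _).trans (add_le_add ?_ (add_le_add ?_ ?_))
      · convert b1 i
      · convert b2 i
      · convert b3 i
    rwa [sum_const, card_univ, Fintype.card_fin, nsmul_eq_mul] at h2
  have hlo := hlow S a b H x z hx hz2
  have e1 : k * (2 * (x / z)) ≤ c / 8 * T := by
    have h1 := hX₁' z ((le_max_left _ _).trans hz)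
    rw [Real.rpow_one] at h1
    rw [hT, mul_div_assoc', mul_div_assoc', mul_div_assoc', div_le_div_iff₀ (by linarith) (by positivity)]
    calc k * (2 * x) * Real.log z ^ k = c / 8 * x * (8 / c * (2 * k) * Real.log z ^ k) := by
          field_simp
      _ ≤ _ := mul_le_mul_of_nonneg_left h1 (by positivity)
  have e2 : K * w ≤ c / 8 * T := by
    have h1 := hX₂' x (((le_max_right _ _).trans hz).trans hzx')
    rw [← hwr] at h1
    have h2 : Real.log z ^ k ≤ Real.log x ^ k :=
      pow_le_pow_left₀ hlz.le (Real.log_le_log (by linarith) hzx') k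
    rw [hT, mul_div_assoc', le_div_iff₀ (by positivity)]
    have hww : w * w = x := Real.mul_self_sqrt hx0.le
    calc K * w * Real.log z ^ k ≤ K * w * Real.log x ^ k :=
          mul_le_mul_of_nonneg_left h2 (by positivity)
      _ = c / 8 * w * (8 / c * K * Real.log x ^ k) := by field_simp
      _ ≤ c / 8 * w * w := mul_le_mul_of_nonneg_left h1 (by positivity)
      _ = c / 8 * x := by rw [mul_assoc, hww]
  have e3 : (k : ℝ) * (c / (4 * k) * T) = c / 4 * T := by field_simp
  have e4 : min (c / 2) (1 / 2) * T ≤ c / 2 * T := mul_le_mul_of_nonneg_right (min_le_left _ _) hT0.le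
  have e5 : K * w = w + 4 * k * w + k * Real.sqrt (coeffBound a b) * w := by rw [hK]; ring
  have e6 : k * (3 * w + (2 * (x / z) + Real.sqrt (coeffBound a b) * w + (c / (4 * k) * T + w))) =
      4 * k * w + k * Real.sqrt (coeffBound a b) * w + k * (2 * (x / z)) + k * (c / (4 * k) * T) := by
    ring
  -- The losses `c / 8`, `c / 8` and `c / 4` leave `c / 2` of the main term.
  linarith

/-! ### Reciprocal sums over sparse sets of primes -/

/-- Chebyshev's bound with cut at `√x` has main constant `4 * log 2`; the remaining `√x` is at most
`2 * x / log x`, and `4 * log 2 + 2 < 5`. -/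
lemma primeCounting_floor_le {x : ℝ} (hx : 1 < x) :
    (Nat.primeCounting ⌊x⌋₊ : ℝ) ≤ 5 * (x / Real.log x) := by
  have h := Chebyshev.pi_le_log4_mul_div hx
  have hlx : 0 < Real.log x := Real.log_pos hx
  have hs : 0 < Real.sqrt x := Real.sqrt_pos.2 (by linarith)
  have hls : Real.log (Real.sqrt x) = Real.log x / 2 := Real.log_sqrt (by linarith)
  have h1 : Real.sqrt x ≤ 2 * (x / Real.log x) := by
    rw [mul_div_assoc', le_div_iff₀ hlx]
    have h2 := Real.log_le_sub_one_of_pos hs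
    rw [hls] at h2
    nlinarith [Real.mul_self_sqrt (show 0 ≤ x by linarith)]
  rw [hls, log_four_eq] at h
  have e : 2 * Real.log 2 * x / (Real.log x / 2) = 4 * Real.log 2 * (x / Real.log x) := by
    field_simp; ring
  rw [e] at h
  have h3 : 0 < x / Real.log x := div_pos (by linarith) hlx
  nlinarith [Real.log_two_lt_d9]

lemma ncard_inter_le_primeCounting {P : Set ℕ} (hP : ∀ p ∈ P, p.Prime) (n : ℕ) :
    (P ∩ Set.Icc 1 n).ncard ≤ Nat.primeCounting n := by
  rw [← Nat.primesLE_card_eq_primeCounting, ← Set.ncard_coe_finset]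
  refine Set.ncard_le_ncard (fun p hp => ?_) (finite_toSet _)
  exact Nat.mem_primesLE.2 ⟨hp.2.2, hP p hp.1⟩

/-- The counting function of a set of primes of small relative upper density. -/
lemma exists_ncard_le_of_relUpperDensity_lt {P : Set ℕ} (hP : ∀ p ∈ P, p.Prime) {δ : ℝ}
    (h : relUpperDensity P < δ) :
    ∃ T : ℝ, 2 ≤ T ∧ ∀ t : ℝ, T ≤ t →
      ((P ∩ Set.Icc 1 ⌊t⌋₊).ncard : ℝ) ≤ δ * Nat.primeCounting ⌊t⌋₊ := by
  -- A real `limsup` carries information only for a function bounded above; the ratio never exceeds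
  -- `1`.
  have hev := Filter.eventually_lt_of_limsup_lt h
    (Filter.isBoundedUnder_of ⟨1, fun x => div_le_one_of_le₀
      (by exact_mod_cast ncard_inter_le_primeCounting hP _) (Nat.cast_nonneg _)⟩)
  obtain ⟨T, hT⟩ := Filter.eventually_atTop.1 hev
  refine ⟨max T 2, le_max_right _ _, fun t ht => ?_⟩
  have h1 := hT t ((le_max_left _ _).trans ht)
  have h2 : 2 ≤ ⌊t⌋₊ := Nat.le_floor (by exact_mod_cast (le_max_right _ _).trans ht)
  have h3 : 0 < Nat.primeCounting ⌊t⌋₊ := by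
    rw [Nat.pos_iff_ne_zero, Ne, Nat.primeCounting_eq_zero_iff]; omega
  exact ((div_lt_iff₀ (by exact_mod_cast h3)).1 h1).le

/-- The sum of the reciprocals of the elements of a sparse set of primes between a power of `x`
and `x`. -/
lemma sum_inv_le_of_ncard_le {P : Set ℕ} {δ T : ℝ} (hδ : 0 ≤ δ)
    (hT : ∀ t : ℝ, T ≤ t → ((P ∩ Set.Icc 1 ⌊t⌋₊).ncard : ℝ) ≤ δ * Nat.primeCounting ⌊t⌋₊)
    {η x : ℝ} (hη : 0 < η) (hx : 2 ≤ x) (hTx : T ≤ x ^ η) (A : Finset ℕ)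
    (hA : ∀ p ∈ A, p ∈ P ∧ x ^ η ≤ p ∧ (p : ℝ) ≤ x) :
    ∑ p ∈ A, 1 / (p : ℝ) ≤ 30 * δ / η := by
  have hlx := log_pos_of_two_le hx
  have hx0 : 0 < x := by linarith
  have hxη : 0 < x ^ η := Real.rpow_pos_of_pos hx0 η
  set L := Nat.log 2 ⌊x⌋₊ with hL
  have hmaps : ∀ p ∈ A, Nat.log 2 p ∈ range (L + 1) := fun p hp =>
    mem_range.2 (Nat.lt_succ_of_le (Nat.log_mono_right (Nat.le_floor (hA p hp).2.2)))
  -- Dyadic blocks: a nonempty one reaches beyond `x ^ η ≥ T`, so the density bound and Chebyshev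
  -- apply at its upper end, where `log t ≥ η * log x`. There are at most `3 * log x` blocks.
  have hfib : ∀ j ∈ range (L + 1), ∑ p ∈ A with Nat.log 2 p = j, 1 / (p : ℝ) ≤
      10 * δ / (η * Real.log x) := fun j _ => by
    rcases (A.filter fun p => Nat.log 2 p = j).eq_empty_or_nonempty with h | ⟨q, hq⟩
    · rw [h, sum_empty]; positivity
    · obtain ⟨hqA, hqj⟩ := mem_filter.1 hq
      have hpos : ∀ p ∈ A, p ≠ 0 := fun p hp h0 => by
        have := (hA p hp).2.1
        rw [h0] at this
        push_cast at this
        linarith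
      set t : ℝ := ((2 ^ (j + 1) : ℕ) : ℝ) with ht
      have hxt : x ^ η ≤ t := (hA q hqA).2.1.trans (by
        rw [ht, Nat.cast_le, ← hqj]; exact (Nat.lt_pow_succ_log_self one_lt_two q).le)
      have h1 := hT t (hTx.trans hxt)
      rw [ht, Nat.floor_natCast] at h1
      have h2 : ((A.filter fun p => Nat.log 2 p = j).card : ℝ) ≤
          (P ∩ Set.Icc 1 (2 ^ (j + 1))).ncard := by
        rw [← Set.ncard_coe_finset, Nat.cast_le]
        refine Set.ncard_le_ncard (fun p hp => ?_) ((Set.finite_Icc _ _).inter_of_right _)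
        obtain ⟨hpA, hpj⟩ := mem_filter.1 (mem_coe.1 hp)
        refine ⟨(hA p hpA).1, Nat.one_le_iff_ne_zero.2 (hpos p hpA), ?_⟩
        rw [← hpj]; exact (Nat.lt_pow_succ_log_self one_lt_two p).le
      have ht1 : 1 < t := by
        rw [ht]; exact_mod_cast Nat.one_lt_two_pow (by omega)
      have h3 := primeCounting_floor_le ht1
      rw [ht, Nat.floor_natCast, ← ht] at h3
      have h4 : η * Real.log x ≤ Real.log t := by
        rw [← Real.log_rpow hx0]; exact Real.log_le_log hxη hxt
      have hlt : 0 < Real.log t := Real.log_pos ht1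
      have htj : t = 2 * 2 ^ j := by rw [ht]; push_cast; ring
      calc ∑ p ∈ A with Nat.log 2 p = j, 1 / (p : ℝ) ≤
            ∑ p ∈ A with Nat.log 2 p = j, 1 / (2 : ℝ) ^ j := sum_le_sum fun p hp => by
              obtain ⟨hpA, hpj⟩ := mem_filter.1 hp
              refine one_div_le_one_div_of_le (by positivity) ?_
              rw [← hpj]
              exact_mod_cast Nat.pow_log_le_self 2 (hpos p hpA)
        _ = (A.filter fun p => Nat.log 2 p = j).card * (1 / (2 : ℝ) ^ j) := by
            rw [sum_const, nsmul_eq_mul]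
        _ ≤ (δ * (5 * (t / Real.log t))) * (1 / (2 : ℝ) ^ j) := by
            refine mul_le_mul_of_nonneg_right ?_ (by positivity)
            exact h2.trans (h1.trans (mul_le_mul_of_nonneg_left h3 hδ))
        _ = 10 * δ / Real.log t := by rw [htj]; field_simp; ring
        _ ≤ _ := by gcongr
  rw [← sum_fiberwise_of_maps_to hmaps]
  have hLx : ((L + 1 : ℕ) : ℝ) ≤ 3 * Real.log x := by
    have h1 : (2 : ℝ) ^ L ≤ x := by
      have h2 : 2 ^ L ≤ ⌊x⌋₊ := Nat.pow_log_le_self 2 (by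
        have := Nat.le_floor (show ((2 : ℕ) : ℝ) ≤ x by exact_mod_cast hx)
        omega)
      exact le_trans (by exact_mod_cast h2) (Nat.floor_le hx0.le)
    have h2 := Real.log_le_log (by positivity) h1
    rw [Real.log_pow] at h2
    have h3 := Real.log_le_log two_pos hx
    push_cast
    have h4 := Real.log_two_gt_d9
    nlinarith [(Nat.cast_nonneg L : (0 : ℝ) ≤ L)]
  calc _ ≤ ∑ j ∈ range (L + 1), 10 * δ / (η * Real.log x) := sum_le_sum hfib
    _ = ((L + 1 : ℕ) : ℝ) * (10 * δ / (η * Real.log x)) := by simp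
    _ ≤ 3 * Real.log x * (10 * δ / (η * Real.log x)) :=
        mul_le_mul_of_nonneg_right hLx (by positivity)
    _ = _ := by field_simp; ring

/-! ### Values divisible by a large prime -/

/-- The number of `n` in `Ω(x, z)` for which a given form is divisible by a given prime `p ≥ y`,
where `y ≤ z`. -/
lemma exists_card_dvd_linForm_le (k : ℕ) : ∃ E : ℕ, ∀ (S : Finset ℕ) (a b : Fin k → ℤ),
    SieveHypotheses S a b → ∀ (i : Fin k) (x y z : ℝ) (p : ℕ), 2 ≤ y → y ≤ z → p.Prime → p ∉ S →
    y ≤ p → (p : ℝ) ≤ x →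
    (((sieveOmega S a b x z).filter fun n => (p : ℤ) ∣ linForm a b i n).card : ℝ) ≤
      4 * 2 ^ (S.card * k) * (x / p / Real.log y ^ k) + y ^ E := by
  obtain ⟨E, hE⟩ := card_le_of_sifted k
  refine ⟨E, fun S a b H i x y z p hy hyz hp hpS hyp hpx => ?_⟩
  set B := (sieveOmega S a b x z).filter fun n => (p : ℤ) ∣ linForm a b i n with hB
  obtain ⟨r, hr, hroot⟩ := H.exists_root hp hpS (q := 1)
    (fun h => hp.one_lt.ne' (Nat.dvd_one.1 h)) 0 i
  have hmod : ∀ n ∈ B, n % p = r := fun n hn => by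
    refine (hroot (n % p) (Nat.mod_lt _ hp.pos)).1 ?_
    have h1 := dvd_prod_linForm_mod a b {i} 0 1 p n
    simp only [prod_singleton] at h1
    exact h1.1 (by simpa using (mem_filter.1 hn).2)
  have hrep : ∀ n ∈ B, r + p * (n / p) = n := fun n hn => by
    rw [← hmod n hn]; exact Nat.mod_add_div n p
  have hmem : ∀ m ∈ B.image (· / p), r + p * m ∈ B ∧ m < ⌊x⌋₊ / p + 1 := fun m hm => by
    obtain ⟨n, hn, rfl⟩ := mem_image.1 hm
    refine ⟨by rwa [hrep n hn], Nat.lt_succ_of_le (Nat.div_le_div_right ?_)⟩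
    exact (mem_sieveOmega.1 (mem_filter.1 hn).1).1.2
  have hcard : (B.image (· / p)).card = B.card := card_image_of_injOn fun m hm n hn h => by
    rw [← hrep m hm, ← hrep n hn, h]
  have hsift : ∀ m ∈ B.image (· / p), ∀ l : ℕ, l.Prime → (l : ℝ) < y → l ∉ S → ∀ j,
      ¬ (l : ℤ) ∣ linForm a b j (r + p * m) := fun m hm l hl hly hlS j =>
    (mem_sieveOmega.1 (mem_filter.1 (hmem m hm).1).1).2 l hl (hly.trans_le hyz) hlS j
  -- The sieve runs over `m` in `n = r + p * m`; as `y ≤ p`, no sieving prime divides the modulus.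
  -- Both levels equal `y`, so all `k` forms are sieved equally far.
  have h := hE S a b H i y y (⌊x⌋₊ / p + 1) r p (B.image (· / p)) hy le_rfl
    (fun m hm => mem_range.2 (hmem m hm).2) (fun l hl hly _ hd => by
      rw [(Nat.prime_dvd_prime_iff_eq hl hp).1 hd] at hly
      linarith) hsift (fun m hm l hl hly hlS => hsift m hm l hl hly hlS i)
  rw [hcard] at h
  have hp0 : (0 : ℝ) < p := by exact_mod_cast hp.pos
  have hN : ((⌊x⌋₊ / p + 1 : ℕ) : ℝ) ≤ 2 * (x / p) := by
    have h1 : ((⌊x⌋₊ / p : ℕ) : ℝ) ≤ x / p :=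
      Nat.cast_div_le.trans (div_le_div_of_nonneg_right (Nat.floor_le (hp0.le.trans hpx)) hp0.le)
    have h2 : 1 ≤ x / p := (one_le_div hp0).2 hpx
    push_cast
    linarith
  have hly := log_pos_of_two_le hy
  have hk : k - 1 + 1 = k := by have := i.pos; omega
  rw [← pow_succ, hk] at h
  refine h.trans (add_le_add_left ?_ _)
  calc _ ≤ 2 * 2 ^ (S.card * k) * (2 * (x / p) / Real.log y ^ k) := by gcongr
    _ = _ := by ring

open Classical in
/-- If a prime `p` divides `L i (n)` for some `n` in `Ω₁(x, z)`, then `p` and a complementary prime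
divisor of `L i (n)` are at least `z`. -/
lemma le_of_dvd_of_mem_sieveOmegaOne {k : ℕ} {S : Finset ℕ} {a b : Fin k → ℤ}
    (H : SieveHypotheses S a b) (hS : ∀ i, ∀ p ∈ S, (p : ℤ) ∣ a i) {x z : ℝ} (hx : 1 ≤ x)
    {n : ℕ} (hn : n ∈ sieveOmegaOne S a b x z) {i : Fin k} {p : ℕ} (hp : p.Prime)
    (hd : (p : ℤ) ∣ linForm a b i n) :
    p ∉ S ∧ z ≤ p ∧ p * z ≤ coeffBound a b * x := by
  unfold sieveOmegaOne at hn
  obtain ⟨hnO, hn1⟩ := mem_filter.1 hn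
  obtain ⟨⟨-, hnx⟩, hsift⟩ := mem_sieveOmega.1 hnO
  -- A prime of `S` divides `a i`; dividing the value too, it would divide `b i`, against
  -- coprimality.
  have hnotS : ∀ q : ℕ, q.Prime → (q : ℤ) ∣ linForm a b i n → q ∉ S := fun q hq hqd hqS => by
    have h1 := hS i q hqS
    have h2 : (q : ℤ) ∣ b i := (dvd_add_right (h1.mul_right (n : ℤ))).1 hqd
    have h3 := Int.dvd_coe_gcd h1 h2
    rw [H.gcd_eq_one i] at h3
    exact hq.one_lt.ne' (Nat.dvd_one.1 (by exact_mod_cast h3))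
  have hge : ∀ q : ℕ, q.Prime → (q : ℤ) ∣ linForm a b i n → z ≤ q := fun q hq hqd => by
    by_contra! h
    exact hsift q hq h (hnotS q hq hqd) i hqd
  refine ⟨hnotS p hp hd, hge p hp hd, ?_⟩
  obtain ⟨hgt, hnp⟩ := (hn1 i).2
  obtain ⟨m, hm⟩ := Int.natCast_dvd.1 hd
  have hm1 : m ≠ 1 := fun h => by rw [h, mul_one] at hm; exact hnp (hm ▸ hp)
  obtain ⟨q, hq, hqm⟩ := Nat.exists_prime_and_dvd hm1
  have h1 : z ≤ q := hge q hq (Int.natCast_dvd.2 (by rw [hm]; exact hqm.mul_left p))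
  have h2 : p * q ≤ (linForm a b i n).natAbs :=
    Nat.le_of_dvd (by omega) (by rw [hm]; exact Nat.mul_dvd_mul_left p hqm)
  have h3 := natAbs_linForm_le a b i hx ((Nat.le_floor_iff (by linarith)).1 hnx)
  calc (p : ℝ) * z ≤ p * q := mul_le_mul_of_nonneg_left h1 (Nat.cast_nonneg p)
    _ ≤ (linForm a b i n).natAbs := by exact_mod_cast h2
    _ ≤ _ := h3

/-! ### Sparse sets of primes dividing few values -/

open Classical in
theorem theorem4p1 (k s : ℕ) (hk : 0 < k) :
    (∃ η c₁ : ℝ, AreSievingConstants k s η c₁) ∧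
    ∀ η c₁ : ℝ, AreSievingConstants k s η c₁ →
      ∃ ε : ℝ, ε ∈ Set.Ioc (0 : ℝ) (1 / 2) ∧
        ∀ (S : Finset ℕ) (a b : Fin k → ℤ), S.card = s → SieveHypotheses S a b →
          (∀ i, ∀ p ∈ S, (p : ℤ) ∣ a i) →
          ∀ P : Set ℕ, (∀ p ∈ P, p.Prime) → relUpperDensity P ≤ ε →
            ∃ x₀ : ℝ, 2 ≤ x₀ ∧ ∀ x : ℝ, x₀ ≤ x →
              (1 / 2 : ℝ) * ((sieveOmegaOne S a b x (x ^ η)).card : ℝ) ≤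
                (((sieveOmegaOne S a b x (x ^ η)).filter
                  (fun n => ∀ p ∈ P, ¬ (p : ℤ) ∣ ∏ i, linForm a b i n)).card : ℝ) := by
  refine ⟨exists_areSievingConstants k s hk, fun η c₁ ⟨⟨hη0, hη1⟩, ⟨hc0, hc1⟩, hconst⟩ => ?_⟩
  obtain ⟨E, hE⟩ := exists_card_dvd_linForm_le k
  have hk0 : (0 : ℝ) < k := by exact_mod_cast hk
  -- Makes the sieve error `y ^ E` at most `x ^ (η / 2)` for `y = x ^ θ`.
  set θ : ℝ := η / (2 * (E + 1)) with hθ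
  have hθ0 : 0 < θ := by positivity
  have hθE : θ * E ≤ η / 2 := by
    rw [hθ, div_mul_eq_mul_div, div_le_iff₀ (by positivity)]; nlinarith
  have hθη : θ ≤ η := by
    rw [hθ, div_le_iff₀ (by positivity)]; nlinarith [(Nat.cast_nonneg E : (0 : ℝ) ≤ E)]
  set C : ℝ := 4 * 2 ^ (s * k) / θ ^ k + 1 with hC
  have hC0 : 0 < C := by positivity
  -- Chosen so that `60 * k * C * ε / η`, the bad proportion in units of `x / (log x) ^ k`, is at
  -- most half of `c₁ / η ^ k`.
  set ε : ℝ := min (1 / 2) (c₁ * η / (120 * k * C * η ^ k)) with hε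
  have hε0 : 0 < ε := lt_min (by norm_num) (by positivity)
  refine ⟨ε, ⟨hε0, min_le_left _ _⟩, fun S a b hS H hSa P hP hdens => ?_⟩
  obtain ⟨z₁, -, hlow⟩ := hconst a b
  -- The density is only at most `ε`; `2 * ε` gives the strict inequality needed for an eventual
  -- bound.
  obtain ⟨T, hT2, hT⟩ := exists_ncard_le_of_relUpperDensity_lt hP (δ := 2 * ε) (by linarith)
  set M : ℝ := coeffBound a b + 1 with hM
  have hM0 : 0 < M := by linarith [coeffBound_nonneg a b]
  obtain ⟨X₁, hX₁, hX₁'⟩ := exists_log_pow_le_rpow 0 (max z₁ (max T M)) hη0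
  obtain ⟨X₂, hX₂, hX₂'⟩ := exists_log_pow_le_rpow 0 2 hθ0
  obtain ⟨X₃, hX₃, hX₃'⟩ := exists_log_pow_le_rpow k M (half_pos hη0)
  refine ⟨max X₁ (max X₂ X₃), hX₁.trans (le_max_left _ _), fun x hx => ?_⟩
  have hx1 := (le_max_left _ _).trans hx
  have hx2 := ((le_max_left _ _).trans (le_max_right _ _)).trans hx
  have hx3 := ((le_max_right _ _).trans (le_max_right _ _)).trans hx
  have hxt : 2 ≤ x := hX₁.trans hx1
  have hx0 : 0 < x := by linarith
  have hlx := log_pos_of_two_le hxt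
  set z := x ^ η with hz
  set y := x ^ θ with hy
  have hzmax := hX₁' x hx1
  have hy2 := hX₂' x hx2
  have hMlog := hX₃' x hx3
  rw [pow_zero, mul_one] at hzmax hy2
  have hz1 : z₁ ≤ z := (le_max_left _ _).trans hzmax
  have hTz : T ≤ z := ((le_max_left _ _).trans (le_max_right _ _)).trans hzmax
  have hMz : M ≤ z := ((le_max_right _ _).trans (le_max_right _ _)).trans hzmax
  have hyz : y ≤ z := Real.rpow_le_rpow_of_exponent_le (by linarith) hθη
  have hly : Real.log y = θ * Real.log x := Real.log_rpow hx0 θ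
  have hlz : Real.log z = η * Real.log x := Real.log_rpow hx0 η
  have hz0 : 0 < z := Real.rpow_pos_of_pos hx0 η
  have hlo := hlow S hS H x z hxt hz1 le_rfl
  set W := x / Real.log x ^ k with hW
  have hW0 : 0 < W := by positivity
  have hlo' : c₁ / η ^ k * W ≤ (sieveOmegaOne S a b x z).card := by
    refine le_trans (le_of_eq ?_) hlo
    rw [hlz, hW, mul_pow]
    field_simp
  set Ps := (Icc 1 ⌊x⌋₊).filter fun p => p ∈ P ∧ p ∉ S ∧ z ≤ p ∧ p * z ≤ M * x with hPs
  have hPsx : ∀ p ∈ Ps, (p : ℝ) ≤ x := fun p hp =>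
    (Nat.le_floor_iff hx0.le).1 (mem_Icc.1 (mem_filter.1 hp).1).2
  set bad := (sieveOmegaOne S a b x z).filter
    (fun n => ¬ ∀ p ∈ P, ¬ (p : ℤ) ∣ ∏ i, linForm a b i n) with hbad
  have hcov : bad ⊆ univ.biUnion fun i : Fin k => Ps.biUnion fun p =>
      (sieveOmega S a b x z).filter fun n => (p : ℤ) ∣ linForm a b i n := by
    intro n hn
    obtain ⟨hn1, hn2⟩ := mem_filter.1 hn
    push Not at hn2
    obtain ⟨p, hpP, hpd⟩ := hn2
    have hp := hP p hpP
    obtain ⟨i, -, hpi⟩ := ((Nat.prime_iff_prime_int.1 hp).dvd_finsetProd_iff _).1 hpd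
    obtain ⟨hpS, hzp, hpz⟩ := le_of_dvd_of_mem_sieveOmegaOne H hSa (by linarith) hn1 hp hpi
    have hpz' : p * z ≤ M * x := hpz.trans (by rw [hM]; nlinarith)
    have hpx : (p : ℝ) ≤ x := by
      have h1 : p * z ≤ x * z := hpz'.trans (by
        rw [mul_comm]; exact mul_le_mul_of_nonneg_left hMz hx0.le)
      exact le_of_mul_le_mul_right h1 hz0
    refine mem_biUnion.2 ⟨i, mem_univ i, mem_biUnion.2 ⟨p, mem_filter.2
      ⟨mem_Icc.2 ⟨hp.one_lt.le, Nat.le_floor hpx⟩, hpP, hpS, hzp, hpz'⟩, mem_filter.2 ⟨?_, hpi⟩⟩⟩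
    unfold sieveOmegaOne at hn1
    exact (mem_filter.1 hn1).1
  have hone : ∀ i : Fin k, ∀ p ∈ Ps,
      (((sieveOmega S a b x z).filter fun n => (p : ℤ) ∣ linForm a b i n).card : ℝ) ≤
        C * W * (1 / (p : ℝ)) := fun i p hpm => by
    obtain ⟨-, hpP, hpS, hzp, hpz⟩ := mem_filter.1 hpm
    have hp0 : (0 : ℝ) < p := by exact_mod_cast (hP p hpP).pos
    have h := hE S a b H i x y z p hy2 hyz (hP p hpP) hpS (hyz.trans hzp) (hPsx p hpm)
    rw [hS, hly, mul_pow] at h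
    -- Here compositeness pays off: `p * z ≤ M * x` leaves room `x ^ η / M` in the progression, of
    -- which `y ^ E` takes `x ^ (η / 2)` and the logarithms, with `M`, the rest. The `+ 1` in `C`
    -- absorbs this error.
    have h1 : y ^ E ≤ W * (1 / (p : ℝ)) := by
      have h2 : y ^ E ≤ x ^ (η / 2) := by
        rw [hy, ← Real.rpow_mul_natCast hx0.le]
        exact Real.rpow_le_rpow_of_exponent_le (by linarith) hθE
      refine h2.trans ?_
      rw [hW, mul_one_div, div_div, le_div_iff₀ (by positivity)]
      have h3 : x ^ (η / 2) * x ^ (η / 2) = z := by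
        rw [← Real.rpow_add hx0, add_halves]
      have h4 : M * (x ^ (η / 2) * (Real.log x ^ k * p)) ≤ M * x := by
        calc M * (x ^ (η / 2) * (Real.log x ^ k * p)) =
              x ^ (η / 2) * p * (M * Real.log x ^ k) := by ring
          _ ≤ x ^ (η / 2) * p * x ^ (η / 2) := mul_le_mul_of_nonneg_left hMlog (by positivity)
          _ = p * z := by rw [← h3]; ring
          _ ≤ M * x := hpz
      exact le_of_mul_le_mul_left h4 hM0
    have e : 4 * 2 ^ (s * k) * (x / p / (θ ^ k * Real.log x ^ k)) =
        4 * 2 ^ (s * k) / θ ^ k * W * (1 / (p : ℝ)) := by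
      rw [hW]; field_simp
    rw [e] at h
    calc _ ≤ 4 * 2 ^ (s * k) / θ ^ k * W * (1 / (p : ℝ)) + W * (1 / (p : ℝ)) := by linarith
      _ = _ := by rw [hC]; ring
  have hsum : ∑ p ∈ Ps, 1 / (p : ℝ) ≤ 30 * (2 * ε) / η :=
    sum_inv_le_of_ncard_le (by positivity) hT hη0 hxt hTz Ps fun p hp =>
      ⟨(mem_filter.1 hp).2.1, (mem_filter.1 hp).2.2.2.1, hPsx p hp⟩
  have hbadcard : (bad.card : ℝ) ≤ k * (C * W * (30 * (2 * ε) / η)) := by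
    calc (bad.card : ℝ) ≤ ∑ i : Fin k, ∑ p ∈ Ps,
          (((sieveOmega S a b x z).filter fun n => (p : ℤ) ∣ linForm a b i n).card : ℝ) := by
          have h1 := (card_le_card hcov).trans (card_biUnion_le.trans
            (sum_le_sum fun i _ => card_biUnion_le))
          refine (Nat.cast_le.2 h1).trans ?_
          push_cast
          rfl
      _ ≤ ∑ i : Fin k, ∑ p ∈ Ps, C * W * (1 / (p : ℝ)) :=
          sum_le_sum fun i _ => sum_le_sum fun p hp => hone i p hp
      _ = k * (C * W * ∑ p ∈ Ps, 1 / (p : ℝ)) := by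
          rw [← mul_sum, sum_const, card_univ, Fintype.card_fin, nsmul_eq_mul]
      _ ≤ _ := by gcongr
  have hfinal : k * (C * W * (30 * (2 * ε) / η)) ≤ 1 / 2 * (c₁ / η ^ k * W) := by
    have h1 : ε ≤ c₁ * η / (120 * k * C * η ^ k) := min_le_right _ _
    calc k * (C * W * (30 * (2 * ε) / η)) = 60 * k * C * W / η * ε := by ring
      _ ≤ 60 * k * C * W / η * (c₁ * η / (120 * k * C * η ^ k)) :=
          mul_le_mul_of_nonneg_left h1 (by positivity)
      _ = _ := by field_simp; norm_num
  have hsplit := card_filter_add_card_filter_not (s := sieveOmegaOne S a b x z)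
    (fun n => ∀ p ∈ P, ¬ (p : ℤ) ∣ ∏ i, linForm a b i n)
  have hsplit' : (((sieveOmegaOne S a b x z).filter
      (fun n => ∀ p ∈ P, ¬ (p : ℤ) ∣ ∏ i, linForm a b i n)).card : ℝ) + bad.card =
      (sieveOmegaOne S a b x z).card := by exact_mod_cast hsplit
  linarith
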